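/- Let $n\ge 0$ and let $\Gamma$ be a discrete group of type $F_n$ (that is, $\Gamma$ has an Eilenberg–MacLane space $K(\Gamma,1)$ which is a CW complex with finite $n$-skeleton; equivalently, $\Gamma$ acts freely by simplicial automorphisms on a nonempty simplicial complex which is $(n-1)$-connected and has only finitely many $\Gamma$-orbits of simplices of dimension $\le n$) and of cohomological dimension $n$ (that is, the trivial $\mathbb{Z}[\Gamma]$-module $\mathbb{Z}$ has projective dimension $n$). Let $S$ be a finite generating set of $\Gamma$, let $\mathcal{H}$ be a complex Hilbert space with unitary group $U(\mathcal{H})$, and equip the set $\operatorname{Hom}(\Gamma,U(\mathcal{H}))$ of group homomorphisms with the topology of the metric $$d_S(\pi,\rho)=\sup_{s\in S}\Vert \pi(s)-\rho(s)\Vert ,$$ where $\Vert\cdot\Vert$ is the operator norm. For $\pi\in \operatorname{Hom}(\Gamma,U(\mathcal{H}))$ let $H^n(\Gamma,\pi)$ denote the $n$-th group cohomology of $\Gamma$ with coefficients in the $\Gamma$-module $(\mathcal{H},\pi)$. Then the set $$N_{\Gamma,\mathcal{H}}=\{\pi\in\operatorname{Hom}(\Gamma,U(\mathcal{H})) : H^n(\Gamma,\pi)\neq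 0\}$$ is closed in $\operatorname{Hom}(\Gamma,U(\mathcal{H}))$. -/

import Mathlib

open scoped Topology

/-! ### Geometric realization of an abstract simplicial complex -/

/-- The geometric realization `|K|` of an abstract simplicial complex `K`: the functions
`x : V → ℝ` (barycentric coordinates) which are non-negative, vanish outside some face, and whose
coordinates sum to `1`. -/
def SimplicialRealization {V : Type*} (K : AbstractSimplicialComplex V) : Type _ :=
  {x : V → ℝ // (∀ v, 0 ≤ x v) ∧ ∃ s ∈ K.faces, (∀ v, v ∉ s → x v = 0) ∧ ∑ v ∈ s, x v = 1}

namespace SimplicialRealization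

variable {V : Type*} (K : AbstractSimplicialComplex V)

/-- The closed simplex of `|K|` spanned by the finite set `s` of vertices. -/
def closedSimplex (s : Finset V) : Set (SimplicialRealization K) :=
  {x | ∀ v, v ∉ s → x.1 v = 0}

/-- The weak (coherent) topology of `|K|`: every closed simplex carries its Euclidean topology (the
topology of the barycentric coordinates), and a set is open in `|K|` if and only if its
intersection with each closed simplex is open in that simplex. -/
instance instTopologicalSpace : TopologicalSpace (SimplicialRealization K) :=
  ⨆ s : {s : Finset V // s ∈ K.faces},
    TopologicalSpace.coinduced
      (Subtype.val : closedSimplex K s.1 → SimplicialRealization K)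
      (TopologicalSpace.induced (fun x : closedSimplex K s.1 => (x.1.1 : V → ℝ))
        Pi.topologicalSpace)

end SimplicialRealization

/-! ### Connectivity -/

/-- `X` is `(n - 1)`-connected: `X` is nonempty and every continuous map from the sphere `S^k` to
`X` with `k ≤ n - 1` extends to a continuous map from the ball `D^(k+1)` to `X`. For `n = 0` this
says that `X` is nonempty, for `n = 1` that `X` is path connected, for `n = 2` that it is simply
connected. -/
def IsPredConnected (n : ℕ) (X : Type*) [TopologicalSpace X] : Prop :=
  Nonempty X ∧ ∀ k : ℕ, k < n →
    ∀ f : C(Metric.sphere (0 : EuclideanSpace ℝ (Fin (k + 1))) 1, X),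
      ∃ F : C(Metric.closedBall (0 : EuclideanSpace ℝ (Fin (k + 1))) 1, X),
        ∀ x : Metric.sphere (0 : EuclideanSpace ℝ (Fin (k + 1))) 1,
          F ⟨x.1, Metric.sphere_subset_closedBall x.2⟩ = f x

/-! ### Finiteness properties of groups -/

/-- The translate `g • σ` of a finite set `σ` of vertices. -/
def translateSimplex {Γ : Type*} [Group Γ] {V : Type*} [MulAction Γ V] (g : Γ) (σ : Finset V) :
    Finset V :=
  σ.map (MulAction.toPerm g).toEmbedding

/-- `Γ` is of type `F_n`: it has an Eilenberg-MacLane space with finite `n`-skeleton. This is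
expressed on the universal cover: `Γ` acts freely by simplicial automorphisms on an
`(n - 1)`-connected simplicial complex with only finitely many orbits of simplices of
dimension `≤ n`. (Attaching free orbits of cells of dimension `≥ n + 1` kills the remaining homotopy
groups without changing the `n`-skeleton, and produces a contractible free `Γ`-complex, whose
quotient is the Eilenberg-MacLane space. The high-dimensional cells are left out since in an
abstract simplicial complex, unlike in a CW complex, all simplices are determined by
their vertices: asking the complex itself to be contractible would force `Γ` to be of type `F` as
soon as `n ≥ 1`.)

A simplex with `m` vertices has dimension `m - 1`. -/
def IsTypeF (n : ℕ) (Γ : Type) [Group Γ] : Prop :=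
  ∃ (V : Type) (_ : MulAction Γ V) (K : AbstractSimplicialComplex V),
    -- the action is simplicial
    (∀ (g : Γ), ∀ σ ∈ K.faces, translateSimplex g σ ∈ K.faces) ∧
    -- the action is free: no nontrivial element stabilizes a simplex
    (∀ (g : Γ), ∀ σ ∈ K.faces, translateSimplex g σ = σ → g = 1) ∧
    -- the `n`-skeleton is finite modulo `Γ`
    (∃ T : Set (Finset V), T.Finite ∧ T ⊆ K.faces ∧
      ∀ σ ∈ K.faces, σ.card ≤ n + 1 → ∃ g : Γ, ∃ τ ∈ T, σ = translateSimplex g τ) ∧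
    IsPredConnected n (SimplicialRealization K)

/-- The cohomological dimension of `Γ`: the projective dimension of the trivial
`ℤ[Γ]`-module `ℤ`. -/
noncomputable def cohomologicalDimension (Γ : Type) [Group Γ] : WithBot ℕ∞ :=
  CategoryTheory.projectiveDimension (Rep.trivial ℤ Γ ℤ)

/-! ### The space of unitary representations -/

section Unitary

variable {Γ : Type} [Group Γ] {H : Type} [NormedAddCommGroup H] [InnerProductSpace ℂ H]
  [CompleteSpace H]

/-- The `Γ`-module underlying a unitary representation `π : Γ → U(H)`. -/
noncomputable def unitaryRep (π : Γ →* unitary (H →L[ℂ] H)) : Representation ℂ Γ H :=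
  (ContinuousLinearMap.toLinearMapRingHom.toMonoidHom :
      (H →L[ℂ] H) →* (H →ₗ[ℂ] H)).comp ((unitary (H →L[ℂ] H)).subtype.comp π)

/-- The restriction of a representation to `S`, as a family of bounded operators. -/
noncomputable def restrictToGenerators (S : Finset Γ) (π : Γ →* unitary (H →L[ℂ] H)) : S → (H →L[ℂ] H) :=
  fun s => (π s : H →L[ℂ] H)

theorem restrictToGenerators_injective (S : Finset Γ)
    (hS : Subgroup.closure (S : Set Γ) = ⊤) :
    Function.Injective
      (restrictToGenerators S : (Γ →* unitary (H →L[ℂ] H)) → S → (H →L[ℂ] H)) := by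
  intro π ρ h
  refine MonoidHom.eq_of_eqOn_dense hS fun s hs => Subtype.ext ?_
  exact congrFun h ⟨s, hs⟩

/-- The metric `d_S(π, ρ) = sup_{s ∈ S} ‖π(s) - ρ(s)‖` on `Hom(Γ, U(H))`, for a finite generating
set `S` of `Γ`. -/
noncomputable abbrev homMetric (S : Finset Γ) (hS : Subgroup.closure (S : Set Γ) = ⊤) :
    MetricSpace (Γ →* unitary (H →L[ℂ] H)) :=
  MetricSpace.induced (restrictToGenerators S) (restrictToGenerators_injective S hS) inferInstance

theorem homMetric_dist (S : Finset Γ) (hS : Subgroup.closure (S : Set Γ) = ⊤)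
    (π ρ : Γ →* unitary (H →L[ℂ] H)) :
    (homMetric S hS).dist π ρ = ⨆ s : S, ‖(π s : H →L[ℂ] H) - (ρ s : H →L[ℂ] H)‖ := by
  change dist (restrictToGenerators S π) (restrictToGenerators S ρ) = _
  rw [dist_eq_norm]
  rcases isEmpty_or_nonempty S with hE | hE
  · rw [Real.iSup_of_isEmpty]
    exact (pi_norm_le_iff_of_nonneg le_rfl).2 (fun s => hE.elim s) |>.antisymm (norm_nonneg _)
  · refine le_antisymm ((pi_norm_le_iff_of_nonempty _).2 fun s => ?_) (ciSup_le fun s => ?_)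
    · exact le_ciSup (f := fun s : S => ‖(π s : H →L[ℂ] H) - (ρ s : H →L[ℂ] H)‖)
        (Set.finite_range _).bddAbove s
    · exact norm_le_pi_norm (restrictToGenerators S π - restrictToGenerators S ρ) s

/-- The topology of the metric `d_S` on `Hom(Γ, U(H))`. -/
noncomputable abbrev homTopology (S : Finset Γ) (hS : Subgroup.closure (S : Set Γ) = ⊤) :
    TopologicalSpace (Γ →* unitary (H →L[ℂ] H)) :=
  (homMetric S hS).toPseudoMetricSpace.toUniformSpace.toTopologicalSpace

variable (Γ H) in
/-- The set of unitary representations `π` of `Γ` on `H` with `H^n(Γ, π) ≠ 0`. -/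
def nonvanishingSet (n : ℕ) : Set (Γ →* unitary (H →L[ℂ] H)) :=
  {π | Nontrivial (groupCohomology (Rep.of (unitaryRep π)) n)}

end Unitary

/-! The complement of the set is open because, for such `Γ`, vanishing of `H^n(Γ, π)` amounts to
surjectivity of a bounded operator between fixed Banach spaces which depends norm continuously on
`π`.

Let `C_m` be the chains on sequences of `m` vertices spanning a face of the complex given by
`IsTypeF`, with `C_0 = ℤ` as augmentation, and let `Z_m` be its cycles. For `m ≥ 1` the action on
sequences is free, so `C_m` is projective; connectivity makes `0 → Z_(m+1) → C_(m+1) → Z_m → 0`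
exact for `m ≤ n`. Since `ℤ` has projective dimension at most `n`, the syzygy `Z_n` is projective,
and it is finitely generated as a quotient of `C_(n+1)`. For `n ≥ 1`, dimension shifting turns
`Ext^n(ℤ, A) = 0` into extendability of every map `Z_n → A` to `C_n`
(`exists_projective_of_isTypeF`). For `A = (H, π)`, presenting both modules as summands of free
modules of finite rank turns this into surjectivity of an operator between finite powers of `H`
(`isOpen_setOf_forall_exists_comp_eq`), an open condition by the open mapping theorem.

The topological input is exactness (`exists_boundary_eq`), proved by simplicial approximation
without singular homology: cones over the simplices of a cycle are mapped continuously to the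
realization, finely subdivided at the chain level, and their points are moved to nearby vertices of
the complex. -/

/-! ### Augmented ordered chains -/

/-- Augmented ordered chains: integral combinations of finite sequences of points. The empty
sequence spans the augmentation. -/
abbrev ListChain (X : Type*) := List X →₀ ℤ

namespace ListChain

variable {X Y : Type*}

/-- The cone operator, which puts the point `x` in front of each sequence. -/
noncomputable def cone (x : X) : ListChain X →ₗ[ℤ] ListChain X :=
  Finsupp.lmapDomain ℤ ℤ (List.cons x)

/-- The linear map on chains with prescribed values on sequences. -/
noncomputable def extend (f : List X → ListChain Y) : ListChain X →ₗ[ℤ] ListChain Y :=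
  Finsupp.linearCombination ℤ f

@[simp] theorem cone_single (x : X) (l : List X) (a : ℤ) :
    cone x (Finsupp.single l a) = Finsupp.single (x :: l) a := by
  simp [cone, Finsupp.mapDomain_single]

@[simp] theorem extend_single_one (f : List X → ListChain Y) (l : List X) :
    extend f (Finsupp.single l 1) = f l := by
  simp [extend]

/-- The boundary of a sequence of points. -/
noncomputable def listBoundary : List X → ListChain X
  | [] => 0
  | x :: l => Finsupp.single l 1 - cone x (listBoundary l)

/-- The boundary operator. -/
noncomputable def boundary : ListChain X →ₗ[ℤ] ListChain X := extend listBoundary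

theorem linearMap_ext {M : Type*} [AddCommGroup M] {f g : ListChain X →ₗ[ℤ] M}
    (h : ∀ l, f (Finsupp.single l 1) = g (Finsupp.single l 1)) : f = g :=
  Finsupp.lhom_ext' fun l => LinearMap.ext_ring (h l)

@[simp] theorem boundary_nil : boundary (Finsupp.single ([] : List X) 1) = 0 := by
  simp [boundary, listBoundary]

/-- The recursion defining the boundary, extended linearly. With the empty sequence included there
is no exceptional formula in low degree, so later identities follow by induction on cones. -/
theorem boundary_cone (x : X) (c : ListChain X) :
    boundary (cone x c) = c - cone x (boundary c) := by
  have h : boundary ∘ₗ cone x = LinearMap.id - cone x ∘ₗ boundary :=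
    linearMap_ext fun l => by simp [boundary, listBoundary]
  exact LinearMap.congr_fun h c

theorem boundary_boundary (c : ListChain X) : boundary (boundary c) = 0 := by
  have h : boundary ∘ₗ boundary = (0 : ListChain X →ₗ[ℤ] ListChain X) :=
    linearMap_ext fun l => by
      induction l with
      | nil => simp
      | cons x l ih =>
        have ih' : boundary (boundary (Finsupp.single l 1)) = 0 := ih
        simp only [LinearMap.comp_apply, LinearMap.zero_apply]
        rw [← cone_single, boundary_cone, map_sub, boundary_cone, ih']
        simp
  exact LinearMap.congr_fun h c

/-- The chain map induced by a map of points. -/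
noncomputable def push (f : X → Y) : ListChain X →ₗ[ℤ] ListChain Y :=
  Finsupp.lmapDomain ℤ ℤ (List.map f)

@[simp] theorem push_single (f : X → Y) (l : List X) (a : ℤ) :
    push f (Finsupp.single l a) = Finsupp.single (l.map f) a := by
  simp [push, Finsupp.mapDomain_single]

theorem push_cone (f : X → Y) (x : X) (c : ListChain X) :
    push f (cone x c) = cone (f x) (push f c) := by
  have h : push f ∘ₗ cone x = cone (f x) ∘ₗ push f := linearMap_ext fun l => by simp
  exact LinearMap.congr_fun h c

theorem boundary_push (f : X → Y) (c : ListChain X) :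
    boundary (push f c) = push f (boundary c) := by
  have h : boundary ∘ₗ push f = push f ∘ₗ boundary := linearMap_ext fun l => by
    induction l with
    | nil => simp
    | cons x l ih =>
      have ih' : boundary (push f (Finsupp.single l 1)) = push f (boundary (Finsupp.single l 1)) :=
        ih
      simp only [LinearMap.comp_apply]
      rw [← cone_single, push_cone, boundary_cone, boundary_cone, map_sub, push_cone, ih']
  exact LinearMap.congr_fun h c

/-- The prism over a sequence of points, between the chain map induced by `f` and `T`. -/
noncomputable def listPrism (f : X → Y) (T : ListChain X →ₗ[ℤ] ListChain Y) :
    List X → ListChain Y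
  | [] => 0
  | x :: l => cone (f x) (T (Finsupp.single (x :: l) 1) - listPrism f T l)

/-- The prism operator, a homotopy from the chain map induced by `f` to the chain map `T`. -/
noncomputable def prism (f : X → Y) (T : ListChain X →ₗ[ℤ] ListChain Y) :
    ListChain X →ₗ[ℤ] ListChain Y :=
  extend (listPrism f T)

theorem prism_cone (f : X → Y) (T : ListChain X →ₗ[ℤ] ListChain Y) (x : X) (c : ListChain X) :
    prism f T (cone x c) = cone (f x) (T (cone x c) - prism f T c) := by
  have h : prism f T ∘ₗ cone x = cone (f x) ∘ₗ (T ∘ₗ cone x - prism f T) :=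
    linearMap_ext fun l => by simp [prism, listPrism]
  exact LinearMap.congr_fun h c

/-- The usual inductive construction of a homotopy: what remains to be filled over `x :: l` is coned
off from `f x`, and the inductive hypothesis for `l` identifies the boundary of that remainder. The
two maps have to agree on the empty sequence to start. -/
theorem boundary_prism (f : X → Y) (T : ListChain X →ₗ[ℤ] ListChain Y)
    (hT : ∀ c, boundary (T c) = T (boundary c))
    (hT0 : T (Finsupp.single [] 1) = Finsupp.single [] 1) (c : ListChain X) :
    boundary (prism f T c) + prism f T (boundary c) = T c - push f c := by
  have h : boundary ∘ₗ prism f T + prism f T ∘ₗ boundary = T - push f :=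
    linearMap_ext fun l => by
      induction l with
      | nil => simp [hT0, prism, listPrism]
      | cons x l ih =>
        simp only [LinearMap.comp_apply, LinearMap.add_apply, LinearMap.sub_apply] at ih ⊢
        rw [← cone_single]
        generalize Finsupp.single l (1 : ℤ) = c at *
        have ih' : push f c = T c - (boundary (prism f T c) + prism f T (boundary c)) := by
          rw [ih]; abel
        rw [prism_cone, boundary_cone, map_sub boundary, hT, boundary_cone, map_sub (prism f T),
          prism_cone, push_cone, ih']
        simp only [map_sub, map_add]
        abel
  exact LinearMap.congr_fun h c

theorem extend_mem_supported {f : List X → ListChain Y} {s : Set (List X)} {t : Set (List Y)}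
    (h : ∀ l ∈ s, f l ∈ Finsupp.supported ℤ ℤ t) {c : ListChain X}
    (hc : c ∈ Finsupp.supported ℤ ℤ s) : extend f c ∈ Finsupp.supported ℤ ℤ t := by
  rw [extend, Finsupp.linearCombination_apply]
  exact Submodule.sum_mem _ fun l hl => Submodule.smul_mem _ _ (h l (hc hl))

theorem eq_extend (T : ListChain X →ₗ[ℤ] ListChain Y) :
    T = extend fun l => T (Finsupp.single l 1) := linearMap_ext fun l => by simp

theorem map_mem_supported {T : ListChain X →ₗ[ℤ] ListChain Y} {s : Set (List X)}
    {t : Set (List Y)} (h : ∀ l ∈ s, T (Finsupp.single l 1) ∈ Finsupp.supported ℤ ℤ t)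
    {c : ListChain X} (hc : c ∈ Finsupp.supported ℤ ℤ s) : T c ∈ Finsupp.supported ℤ ℤ t := by
  rw [eq_extend T]
  exact extend_mem_supported h hc

theorem single_mem_supported {s : Set (List X)} {l : List X} (h : l ∈ s) :
    Finsupp.single l (1 : ℤ) ∈ Finsupp.supported ℤ ℤ s :=
  Finsupp.single_mem_supported ℤ 1 h

theorem cone_mem_supported {x : X} {s t : Set (List X)} (h : ∀ l ∈ s, x :: l ∈ t)
    {c : ListChain X} (hc : c ∈ Finsupp.supported ℤ ℤ s) :
    cone x c ∈ Finsupp.supported ℤ ℤ t :=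
  map_mem_supported (fun l hl => by simpa using single_mem_supported (h l hl)) hc

theorem push_mem_supported {f : X → Y} {s : Set (List X)} {t : Set (List Y)}
    (h : ∀ l ∈ s, l.map f ∈ t) {c : ListChain X} (hc : c ∈ Finsupp.supported ℤ ℤ s) :
    push f c ∈ Finsupp.supported ℤ ℤ t :=
  map_mem_supported (fun l hl => by simpa using single_mem_supported (h l hl)) hc

/-- The boundary of a chain of sequences of length `m + 1` is carried by shorter sequences with
the same points. -/
theorem boundary_single_mem_supported (l : List X) :
    boundary (Finsupp.single l 1) ∈
      Finsupp.supported ℤ ℤ {q : List X | q.length + 1 = l.length ∧ ∀ y ∈ q, y ∈ l} := by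
  induction l with
  | nil => simp
  | cons x l ih =>
    rw [← cone_single, boundary_cone]
    refine Submodule.sub_mem _ (single_mem_supported ⟨rfl, fun y hy => by simp [hy]⟩) ?_
    refine cone_mem_supported (fun q hq => ?_) ih
    refine ⟨by simpa using hq.1, fun y hy => ?_⟩
    rcases List.mem_cons.1 hy with rfl | hy
    · simp
    · simp [hq.2 y hy]

/-- The prism only uses values of `T` on the tails of `l` and cone points `f x`, whence the
hypothesis on suffixes. -/
theorem prism_single_mem_supported (f : X → Y) (T : ListChain X →ₗ[ℤ] ListChain Y)
    (R : X → Y → Prop) (l : List X)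
    (hT : ∀ l', l' <:+ l → T (Finsupp.single l' 1) ∈
      Finsupp.supported ℤ ℤ {q | q.length = l'.length ∧ ∀ y ∈ q, ∃ x ∈ l', R x y}) :
    prism f T (Finsupp.single l 1) ∈
      Finsupp.supported ℤ ℤ {q | q.length = l.length + 1 ∧ ∀ y ∈ q, ∃ x ∈ l, y = f x ∨ R x y} := by
  induction l with
  | nil => simp [prism, listPrism]
  | cons x l ih =>
    have ih' := ih fun l' h => hT l' (h.trans (List.suffix_cons x l))
    rw [← cone_single, prism_cone]
    refine cone_mem_supported (s := {q | q.length = l.length + 1 ∧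
      ∀ y ∈ q, ∃ z ∈ x :: l, y = f z ∨ R z y}) (fun q hq => ?_) ?_
    · refine ⟨by simp [hq.1], fun y hy => ?_⟩
      rcases List.mem_cons.1 hy with rfl | hy
      · exact ⟨x, by simp, .inl rfl⟩
      · exact hq.2 y hy
    · refine Submodule.sub_mem _ ?_ ?_
      · rw [cone_single]
        refine Finsupp.supported_mono ?_ (hT _ (List.suffix_refl _))
        rintro q ⟨h1, h2⟩
        exact ⟨by simpa using h1, fun y hy => let ⟨z, hz, h⟩ := h2 y hy; ⟨z, hz, .inr h⟩⟩
      · refine Finsupp.supported_mono ?_ ih'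
        rintro q ⟨h1, h2⟩
        exact ⟨h1, fun y hy => let ⟨z, hz, h⟩ := h2 y hy; ⟨z, List.mem_cons_of_mem _ hz, h⟩⟩

/-! ### Contraction and subdivision in convex sets -/

variable {ι : Type*}

/-- The point at time `i / N` on the way from `y` to `x`. -/
noncomputable def towards (N : ℕ) (x : ι → ℝ) (i : ℕ) (y : ι → ℝ) : ι → ℝ :=
  fun v => y v + (i / N : ℝ) * (x v - y v)

/-- The contraction of chains to the point `x`, in `N` steps. -/
noncomputable def contraction (N : ℕ) (x : ι → ℝ) : ListChain (ι → ℝ) →ₗ[ℤ] ListChain (ι → ℝ) :=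
  cone x ∘ₗ push (fun _ => x) -
    ∑ i ∈ Finset.range N, prism (towards N x i) (push (towards N x (i + 1)))

/-- The prisms between consecutive times telescope to the difference of the constant map and the
identity; the cone from `x` contracts the constant part. -/
theorem boundary_contraction {N : ℕ} (hN : N ≠ 0) (x : ι → ℝ) (c : ListChain (ι → ℝ)) :
    boundary (contraction N x c) + contraction N x (boundary c) = c := by
  have hN' : (N : ℝ) ≠ 0 := by exact_mod_cast hN
  have h0 : towards N x 0 = id := by ext y v; simp [towards]
  have h1 : towards N x N = fun _ => x := by ext y v; simp [towards, hN']
  have hid : push (id : (ι → ℝ) → ι → ℝ) = LinearMap.id := linearMap_ext fun l => by simp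
  have key : ∑ i ∈ Finset.range N,
      (boundary (prism (towards N x i) (push (towards N x (i + 1))) c) +
        prism (towards N x i) (push (towards N x (i + 1))) (boundary c)) =
      push (fun _ => x) c - c := by
    have : ∀ i ∈ Finset.range N,
        (boundary (prism (towards N x i) (push (towards N x (i + 1))) c) +
        prism (towards N x i) (push (towards N x (i + 1))) (boundary c)) =
        push (towards N x (i + 1)) c - push (towards N x i) c := fun i _ =>
      boundary_prism _ _ (boundary_push _) (by simp) c
    rw [Finset.sum_congr rfl this, Finset.sum_range_sub (fun i => push (towards N x i) c), h0, h1,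
      hid]
    rfl
  rw [Finset.sum_add_distrib] at key
  simp only [contraction, LinearMap.sub_apply, LinearMap.comp_apply, LinearMap.sum_apply, map_sub,
    map_sum, boundary_cone, boundary_push]
  rw [sub_eq_iff_eq_add.1 key.symm]
  abel

/-- The sequences of `m` points of `D` with pairwise distances at most `r`. -/
def fineLists (D : Set (ι → ℝ)) (r : ℝ) (m : ℕ) : Set (List (ι → ℝ)) :=
  {q | q.length = m ∧ (∀ x ∈ q, x ∈ D) ∧ ∀ x ∈ q, ∀ y ∈ q, ∀ v, |x v - y v| ≤ r}

/-- Moving towards `x` does not increase distances, and points of one prism differ by at most one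
time step, which costs `1 / N` as coordinates in `D` differ by at most `1`. -/
theorem contraction_mem_supported {N : ℕ} (hN : N ≠ 0) {x : ι → ℝ} {D : Set (ι → ℝ)}
    (hD : Convex ℝ D) (hD1 : ∀ x ∈ D, ∀ y ∈ D, ∀ v, |x v - y v| ≤ 1) (hx : x ∈ D) {r : ℝ}
    (hr : 0 ≤ r) {m : ℕ} {c : ListChain (ι → ℝ)}
    (hc : c ∈ Finsupp.supported ℤ ℤ (fineLists D r m)) :
    contraction N x c ∈ Finsupp.supported ℤ ℤ (fineLists D (r + 1 / N) (m + 1)) := by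
  have hN' : (0 : ℝ) < N := by positivity
  have hrN : 0 ≤ r + 1 / N := by positivity
  rw [contraction, LinearMap.sub_apply, LinearMap.sum_apply]
  refine Submodule.sub_mem _ ?_ (Submodule.sum_mem _ fun i hi => ?_)
  · refine cone_mem_supported (fun l hl => ?_)
      (push_mem_supported (t := {q | q.length = m ∧ ∀ y ∈ q, y = x}) ?_ hc)
    · have h : ∀ y ∈ x :: l, y = x := fun y hy => (List.mem_cons.1 hy).elim id (hl.2 y)
      refine ⟨by simp [hl.1], fun y hy => h y hy ▸ hx, fun y hy z hz v => ?_⟩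
      rw [h y hy, h z hz]
      simpa using hrN
    · rintro l ⟨hl, -⟩
      refine ⟨by simp [hl], fun y hy => ?_⟩
      simp only [List.mem_map] at hy
      exact hy.choose_spec.2.symm
  · have hi' : i + 1 ≤ N := Finset.mem_range.1 hi
    have hmem : ∀ j ≤ N, ∀ y ∈ D, towards N x j y ∈ D := fun j hj y hy => by
      have h1 : (j / N : ℝ) ≤ 1 := by
        rw [div_le_one hN']; exact_mod_cast hj
      exact hD.add_smul_sub_mem hy hx ⟨by positivity, h1⟩
    have hdist : ∀ j k : ℕ, k ≤ N → (j = k ∨ j + 1 = k) → ∀ y ∈ D, ∀ z ∈ D,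
        (∀ v, |y v - z v| ≤ r) →
        ∀ v, |towards N x j y v - towards N x k z v| ≤ r + 1 / N := by
      intro j k hk hjk y hy z hz hyz v
      have hk1 : (k / N : ℝ) ≤ 1 := by
        rw [div_le_one hN']; exact_mod_cast hk
      have hk0 : (0 : ℝ) ≤ k / N := by positivity
      have hz1 := abs_le.1 (hD1 x hx y hy v)
      have hyz1 := abs_le.1 (hyz v)
      have hNi : (0 : ℝ) ≤ 1 / N := by positivity
      have hj : (j / N : ℝ) = k / N ∨ (j / N : ℝ) = k / N - 1 / N := by
        rcases hjk with rfl | rfl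
        · exact .inl rfl
        · right; push_cast; ring
      have e : ∀ t : ℝ, t = k / N ∨ t = k / N - 1 / N →
          |(y v + t * (x v - y v)) - (z v + (k / N) * (x v - z v))| ≤ r + 1 / N := by
        rintro t (rfl | rfl)
        · rw [show (y v + (k / N : ℝ) * (x v - y v)) - (z v + (k / N) * (x v - z v)) =
            (1 - k / N) * (y v - z v) by ring, abs_le]
          constructor <;> nlinarith
        · rw [show (y v + (k / N - 1 / N : ℝ) * (x v - y v)) - (z v + (k / N) * (x v - z v)) =
            (1 - k / N) * (y v - z v) - 1 / N * (x v - y v) by ring, abs_le]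
          constructor <;> nlinarith
      exact e _ hj
    refine map_mem_supported (fun l hl => ?_) hc
    refine Finsupp.supported_mono ?_ (prism_single_mem_supported _ _
      (fun y z => z = towards N x (i + 1) y) l fun l' _ => ?_)
    · rintro q ⟨hq, hq'⟩
      refine ⟨by rw [hq, hl.1], fun y hy => ?_, fun y hy z hz v => ?_⟩
      · obtain ⟨y', hy', rfl | rfl⟩ := hq' y hy
        · exact hmem i (by omega) _ (hl.2.1 _ hy')
        · exact hmem _ hi' _ (hl.2.1 _ hy')
      · obtain ⟨y', hy', hy⟩ := hq' y hy
        obtain ⟨z', hz', hz⟩ := hq' z hz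
        have hyD := hl.2.1 _ hy'
        have hzD := hl.2.1 _ hz'
        have h1 := hl.2.2 _ hy' _ hz'
        have h2 := hl.2.2 _ hz' _ hy'
        rcases hy with rfl | rfl <;> rcases hz with rfl | rfl
        · exact hdist i i (by omega) (.inl rfl) _ hyD _ hzD h1 v
        · exact hdist i (i + 1) hi' (.inr rfl) _ hyD _ hzD h1 v
        · rw [abs_sub_comm]
          exact hdist i (i + 1) hi' (.inr rfl) _ hzD _ hyD h2 v
        · exact hdist (i + 1) (i + 1) hi' (.inl rfl) _ hyD _ hzD h1 v
    · rw [push_single]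
      refine single_mem_supported ⟨by simp, fun y hy => ?_⟩
      obtain ⟨z, hz, rfl⟩ := List.mem_map.1 hy
      exact ⟨z, hz, rfl⟩

/-- The fine subdivision of the affine simplex with vertices `e x`, for `x` in a sequence. -/
noncomputable def listSubdivision (N : ℕ) (e : X → ι → ℝ) : List X → ListChain (ι → ℝ)
  | [] => Finsupp.single [] 1
  | x :: l => contraction N (e x) (listSubdivision N e l)

/-- The subdivision operator. -/
noncomputable def subdivision (N : ℕ) (e : X → ι → ℝ) : ListChain X →ₗ[ℤ] ListChain (ι → ℝ) :=
  extend (listSubdivision N e)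

theorem subdivision_nil (N : ℕ) (e : X → ι → ℝ) :
    subdivision N e (Finsupp.single [] 1) = Finsupp.single [] 1 := by
  simp [subdivision, listSubdivision]

theorem subdivision_cone (N : ℕ) (e : X → ι → ℝ) (x : X) (c : ListChain X) :
    subdivision N e (cone x c) = contraction N (e x) (subdivision N e c) := by
  have h : subdivision N e ∘ₗ cone x = contraction N (e x) ∘ₗ subdivision N e :=
    linearMap_ext fun l => by simp [subdivision, listSubdivision]
  exact LinearMap.congr_fun h c

theorem boundary_subdivision {N : ℕ} (hN : N ≠ 0) (e : X → ι → ℝ) (c : ListChain X) :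
    boundary (subdivision N e c) = subdivision N e (boundary c) := by
  have h : boundary ∘ₗ subdivision N e = subdivision N e ∘ₗ boundary := linearMap_ext fun l => by
    induction l with
    | nil => simp [subdivision_nil]
    | cons x l ih =>
      simp only [LinearMap.comp_apply] at ih ⊢
      rw [← cone_single, subdivision_cone, boundary_cone, map_sub, subdivision_cone, ← ih]
      exact eq_sub_of_add_eq (boundary_contraction hN _ _)
  exact LinearMap.congr_fun h c

/-- Each point of the sequence contributes one contraction, hence `1 / N` to the mesh; for bounded
length the mesh tends to zero with `N`. -/
theorem subdivision_mem_supported {N : ℕ} (hN : N ≠ 0) (e : X → ι → ℝ) {D : Set (ι → ℝ)}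
    (hD : Convex ℝ D) (hD1 : ∀ x ∈ D, ∀ y ∈ D, ∀ v, |x v - y v| ≤ 1) (l : List X)
    (hl : ∀ x ∈ l, e x ∈ D) :
    subdivision N e (Finsupp.single l 1) ∈
      Finsupp.supported ℤ ℤ (fineLists D (l.length / N) l.length) := by
  induction l with
  | nil =>
    rw [subdivision_nil]
    exact single_mem_supported ⟨rfl, by simp, by simp⟩
  | cons x l ih =>
    rw [← cone_single, subdivision_cone]
    have := contraction_mem_supported hN hD hD1 (hl x (by simp)) (by positivity)
      (ih fun y hy => hl y (by simp [hy]))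
    rwa [List.length_cons, Nat.cast_succ, add_div]

end ListChain

/-! ### Simplices in a space of functions -/

section Simplex

variable {ι : Type*}

/-- The simplex of `ι → ℝ` spanned by the finite set `W` of coordinates. -/
def simplexOn (W : Finset ι) : Set (ι → ℝ) :=
  {x | (∀ v, 0 ≤ x v) ∧ (∀ v, v ∉ W → x v = 0) ∧ ∑ v ∈ W, x v = 1}

theorem convex_simplexOn (W : Finset ι) : Convex ℝ (simplexOn W) := by
  rintro x ⟨hx0, hx1, hx2⟩ y ⟨hy0, hy1, hy2⟩ a b ha hb hab
  refine ⟨fun v => ?_, fun v hv => by simp [hx1 v hv, hy1 v hv], ?_⟩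
  · have := hx0 v
    have := hy0 v
    simp only [Pi.add_apply, Pi.smul_apply, smul_eq_mul]
    positivity
  · simp [Finset.sum_add_distrib, ← Finset.mul_sum, hx2, hy2, hab]

theorem isClosed_simplexOn (W : Finset ι) : IsClosed (simplexOn W) := by
  have : simplexOn W = (⋂ v, {x | 0 ≤ x v}) ∩ (⋂ v, ⋂ (_ : v ∉ W), {x | x v = 0}) ∩
      {x | ∑ v ∈ W, x v = 1} := by
    ext x; simp [simplexOn, and_assoc]
  rw [this]
  refine ((isClosed_iInter fun v => ?_).inter (isClosed_iInter fun v => isClosed_iInter fun _ =>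
    ?_)).inter ?_
  · exact isClosed_le continuous_const (continuous_apply v)
  · exact isClosed_eq (continuous_apply v) continuous_const
  · exact isClosed_eq (by fun_prop) continuous_const

theorem le_one_of_mem_simplexOn {W : Finset ι} {x : ι → ℝ} (hx : x ∈ simplexOn W) (v : ι) :
    x v ≤ 1 := by
  by_cases hv : v ∈ W
  · rw [← hx.2.2]
    exact Finset.single_le_sum (fun i _ => hx.1 i) hv
  · rw [hx.2.1 v hv]; exact zero_le_one

theorem isCompact_simplexOn (W : Finset ι) : IsCompact (simplexOn W) := by
  refine (isCompact_univ_pi fun _ : ι => isCompact_Icc (a := (0 : ℝ)) (b := 1)).of_isClosed_subset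
    (isClosed_simplexOn W) fun x hx v _ => ⟨hx.1 v, le_one_of_mem_simplexOn hx v⟩

theorem abs_sub_le_one_of_mem_simplexOn {W : Finset ι} {x y : ι → ℝ} (hx : x ∈ simplexOn W)
    (hy : y ∈ simplexOn W) (v : ι) : |x v - y v| ≤ 1 := by
  have h1 := le_one_of_mem_simplexOn hx v
  have h2 := le_one_of_mem_simplexOn hy v
  have h3 := hx.1 v
  have h4 := hy.1 v
  rw [abs_le]
  constructor <;> linarith

theorem simplexOn_mono {W W' : Finset ι} (h : W ⊆ W') : simplexOn W ⊆ simplexOn W' := by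
  rintro x ⟨h0, h1, h2⟩
  refine ⟨h0, fun v hv => h1 v fun hv' => hv (h hv'), ?_⟩
  rw [← h2]
  exact (Finset.sum_subset h fun v _ hv => h1 v hv).symm

theorem mem_simplexOn_of_subset {W W' : Finset ι} (h : W' ⊆ W) {x : ι → ℝ} (hx : x ∈ simplexOn W)
    (h0 : ∀ v ∈ W, v ∉ W' → x v = 0) : x ∈ simplexOn W' := by
  refine ⟨hx.1, fun v hv => ?_, ?_⟩
  · by_cases hW : v ∈ W
    · exact h0 v hW hv
    · exact hx.2.1 v hW
  · rw [← hx.2.2]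
    exact Finset.sum_subset h h0

theorem single_mem_simplexOn [DecidableEq ι] {W : Finset ι} {v : ι} (hv : v ∈ W) :
    (Pi.single v 1 : ι → ℝ) ∈ simplexOn W := by
  refine ⟨fun w => ?_, fun w hw => ?_, ?_⟩
  · by_cases h : w = v
    · subst h; simp
    · simp [h]
  · have : w ≠ v := fun h => hw (h ▸ hv)
    simp [this]
  · rw [Finset.sum_eq_single_of_mem v hv]
    · simp
    · intro w _ h; simp [h]

/-- The boundary of the simplex spanned by `W`. -/
def simplexBoundary (W : Finset ι) : Set (ι → ℝ) := {x ∈ simplexOn W | ∃ w ∈ W, x w = 0}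

end Simplex

/-! ### The solid simplex as a convex body, and extension of maps from the boundary of a simplex. -/

/-- The solid simplex spanned by the origin and the coordinate vectors. -/
def cornerSimplex (d : ℕ) : Set (EuclideanSpace ℝ (Fin d)) :=
  {y | (∀ i, 0 ≤ y i) ∧ ∑ i, y i ≤ 1}

section Corner

variable {d : ℕ}

theorem isClosed_cornerSimplex : IsClosed (cornerSimplex d) := by
  have : cornerSimplex d = (⋂ i, {y | 0 ≤ y i}) ∩ {y | ∑ i, y i ≤ 1} := by
    ext; simp [cornerSimplex]
  rw [this]
  refine (isClosed_iInter fun i => isClosed_le continuous_const (by fun_prop)).inter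
    (isClosed_le (by fun_prop) continuous_const)

theorem convex_cornerSimplex : Convex ℝ (cornerSimplex d) := by
  rintro x ⟨hx0, hx1⟩ y ⟨hy0, hy1⟩ a b ha hb hab
  refine ⟨fun v => ?_, ?_⟩
  · have := hx0 v
    have := hy0 v
    simp only [PiLp.add_apply, PiLp.smul_apply, smul_eq_mul]
    positivity
  · simp only [PiLp.add_apply, PiLp.smul_apply, smul_eq_mul, Finset.sum_add_distrib,
      ← Finset.mul_sum]
    nlinarith

theorem isBounded_cornerSimplex : Bornology.IsBounded (cornerSimplex d) := by
  refine (Metric.isBounded_iff_subset_closedBall 0).2 ⟨√d, fun y hy => ?_⟩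
  rw [mem_closedBall_zero_iff, EuclideanSpace.norm_eq]
  refine Real.sqrt_le_sqrt ?_
  calc ∑ i, ‖y i‖ ^ 2 ≤ ∑ _i : Fin d, (1 : ℝ) := by
        refine Finset.sum_le_sum fun i _ => ?_
        have h0 := hy.1 i
        have h1 : y i ≤ 1 := (Finset.single_le_sum (fun j _ => hy.1 j) (Finset.mem_univ i)).trans
          hy.2
        rw [Real.norm_eq_abs, abs_of_nonneg h0]
        nlinarith
    _ = d := by simp

theorem mem_interior_cornerSimplex {y : EuclideanSpace ℝ (Fin d)} (h0 : ∀ i, 0 < y i)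
    (h1 : ∑ i, y i < 1) : y ∈ interior (cornerSimplex d) := by
  have : IsOpen ((⋂ i, {y : EuclideanSpace ℝ (Fin d) | 0 < y i}) ∩ {y | ∑ i, y i < 1}) :=
    (isOpen_iInter_of_finite fun i => isOpen_lt continuous_const (by fun_prop)).inter
      (isOpen_lt (by fun_prop) continuous_const)
  refine mem_interior.2 ⟨_, fun z hz => ?_, this, by simpa using ⟨h0, h1⟩⟩
  simp only [Set.mem_inter_iff, Set.mem_iInter, Set.mem_ofPred_eq] at hz
  exact ⟨fun i => (hz.1 i).le, hz.2.le⟩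

/-- A nonzero functional is an open map, so it sends the interior of `s` into the interior of the
ray `[c, ∞)`. -/
theorem pos_of_mem_interior {E : Type*} [NormedAddCommGroup E] [NormedSpace ℝ E]
    (l : E →L[ℝ] ℝ) (hl : l ≠ 0) {s : Set E} {c : ℝ}
    (hs : ∀ y ∈ s, c ≤ l y) {y : E} (hy : y ∈ interior s) : c < l y := by
  have hl' : Function.Surjective l := LinearMap.surjective (f := (l : E →ₗ[ℝ] ℝ))
    fun h => hl (ContinuousLinearMap.coe_injective h)
  have hopen : IsOpenMap l := l.isOpenMap_of_ne_zero hl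
  have : l '' interior s ⊆ interior (Set.Ici c) := by
    refine interior_maximal ?_ (hopen _ isOpen_interior)
    rintro _ ⟨z, hz, rfl⟩
    exact hs z (interior_subset hz)
  rw [interior_Ici] at this
  exact this ⟨y, hy, rfl⟩

theorem pos_of_mem_interior_cornerSimplex {y : EuclideanSpace ℝ (Fin (d + 1))}
    (hy : y ∈ interior (cornerSimplex (d + 1))) : (∀ i, 0 < y i) ∧ ∑ i, y i < 1 := by
  constructor
  · intro i
    refine pos_of_mem_interior (EuclideanSpace.proj i : EuclideanSpace ℝ (Fin (d + 1)) →L[ℝ] ℝ)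
      (fun h => ?_) (fun z hz => hz.1 i) hy
    simpa using congrArg (fun l => l (EuclideanSpace.single i (1 : ℝ))) h
  · have := pos_of_mem_interior (c := -1)
      (-∑ i, (EuclideanSpace.proj i : EuclideanSpace ℝ (Fin (d + 1)) →L[ℝ] ℝ))
      (fun h => ?_) (fun z hz => ?_) hy
    · simpa using this
    · simpa using congrArg (fun l => l (EuclideanSpace.single 0 (1 : ℝ))) h
    · simpa using hz.2

end Corner

/-- Forgetting one barycentric coordinate identifies the simplex with a convex body in dimension `k
+ 1`. A bounded convex set with nonempty interior has a homeomorphism of the ambient space taking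
its closure to the ball and its frontier to the sphere, where the extension property is available.
-/
theorem exists_continuousOn_simplexOn_extension {ι X : Type*} [TopologicalSpace X] {n k : ℕ}
    (hX : IsPredConnected n X) (hk : k < n) {W : Finset ι} (hW : W.card = k + 2)
    (f : (ι → ℝ) → X) (hf : ContinuousOn f (simplexBoundary W)) :
    ∃ g : (ι → ℝ) → X, ContinuousOn g (simplexOn W) ∧ ∀ x ∈ simplexBoundary W, g x = f x := by
  classical
  let e : Fin (k + 2) ≃ W := (finCongr hW.symm).trans W.equivFin.symm
  let drop : (ι → ℝ) → EuclideanSpace ℝ (Fin (k + 1)) := fun x =>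
    WithLp.toLp 2 fun i => x (e i.succ)
  -- The forgotten coordinate, at `e 0`, is recovered from the condition that the sum is `1`.
  let raise : EuclideanSpace ℝ (Fin (k + 1)) → ι → ℝ := fun y v =>
    if h : v ∈ W then (Fin.cons (1 - ∑ i, y i) (fun i => y i) : Fin (k + 2) → ℝ) (e.symm ⟨v, h⟩)
    else 0
  have hsum : ∀ x : ι → ℝ, ∑ v ∈ W, x v = x (e 0) + ∑ i : Fin (k + 1), x (e i.succ) := fun x => by
    rw [← Fin.sum_univ_succ (fun i => x (e i)), ← Finset.sum_coe_sort W]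
    exact (e.sum_comp fun v : W => x v).symm
  have hraise : ∀ y j, raise y (e j) = (Fin.cons (1 - ∑ i, y i) (fun i => y i) :
      Fin (k + 2) → ℝ) j := fun y j => by
    simp only [raise, (e j).2, dif_pos, Subtype.coe_eta, Equiv.symm_apply_apply]
  have hdrop : Continuous drop := by
    refine (PiLp.continuous_toLp 2 _).comp (continuous_pi fun i => continuous_apply _)
  have hraisec : Continuous raise := by
    refine continuous_pi fun v => ?_
    by_cases h : v ∈ W
    · simp only [raise, h, dif_pos]
      refine Fin.cases ?_ (fun i => ?_) (e.symm ⟨v, h⟩)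
      · simp only [Fin.cons_zero]; fun_prop
      · simp only [Fin.cons_succ]; fun_prop
    · simp only [raise, h, dif_neg, not_false_eq_true]; fun_prop
  have hrd : ∀ x ∈ simplexOn W, raise (drop x) = x := fun x hx => by
    ext v
    by_cases h : v ∈ W
    · obtain ⟨j, hj⟩ := e.surjective ⟨v, h⟩
      obtain rfl : (e j : ι) = v := congrArg Subtype.val hj
      rw [hraise]
      refine Fin.cases ?_ (fun i => ?_) j
      · simp only [Fin.cons_zero, drop]
        rw [← hx.2.2, hsum]; ring
      · simp [drop]
    · simp only [raise, h, dif_neg, not_false_eq_true, hx.2.1 v h]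
  have hdropmem : ∀ x ∈ simplexOn W, drop x ∈ cornerSimplex (k + 1) := fun x hx => by
    refine ⟨fun i => hx.1 _, ?_⟩
    have h1 := hx.2.2
    have h2 := hx.1 (e 0)
    rw [hsum] at h1
    simp only [drop]
    linarith
  have hdropbd : ∀ x ∈ simplexBoundary W, drop x ∈ frontier (cornerSimplex (k + 1)) := by
    rintro x ⟨hx, w, hw, hxw⟩
    rw [isClosed_cornerSimplex.frontier_eq]
    refine ⟨hdropmem x hx, fun hint => ?_⟩
    obtain ⟨h0, h1⟩ := pos_of_mem_interior_cornerSimplex hint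
    obtain ⟨j, hj⟩ := e.surjective ⟨w, hw⟩
    obtain rfl : (e j : ι) = w := congrArg Subtype.val hj
    revert hxw
    refine Fin.cases (fun hxw => ?_) (fun i hxw => ?_) j
    · have h2 := hx.2.2
      rw [hsum, hxw] at h2
      simp only [drop] at h1
      linarith
    · exact (h0 i).ne' hxw
  have hraisebd : ∀ y ∈ frontier (cornerSimplex (k + 1)), raise y ∈ simplexBoundary W := by
    intro y hy
    rw [isClosed_cornerSimplex.frontier_eq] at hy
    obtain ⟨⟨h0, h1⟩, h2⟩ := hy
    refine ⟨⟨fun v => ?_, fun v hv => by simp [raise, hv], ?_⟩, ?_⟩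
    · by_cases h : v ∈ W
      · obtain ⟨j, hj⟩ := e.surjective ⟨v, h⟩
        obtain rfl : (e j : ι) = v := congrArg Subtype.val hj
        rw [hraise]
        refine Fin.cases ?_ (fun i => ?_) j
        · simpa using h1
        · simpa using h0 i
      · simp [raise, h]
    · rw [hsum]
      simp [hraise]
    · by_contra! hne
      refine h2 (mem_interior_cornerSimplex (fun i => (h0 i).lt_of_ne' ?_) (h1.lt_of_ne ?_))
      · simpa [hraise] using hne _ (e i.succ).2
      · have := hne _ (e 0).2
        rw [hraise, Fin.cons_zero] at this
        exact fun h => this (by rw [h, sub_self])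
  have hne : (interior (cornerSimplex (k + 1))).Nonempty := by
    refine ⟨WithLp.toLp 2 fun _ => ((k : ℝ) + 2)⁻¹, mem_interior_cornerSimplex (fun i => ?_) ?_⟩
    · simp only; positivity
    · simp only [Finset.sum_const, Finset.card_univ, Fintype.card_fin, nsmul_eq_mul]
      rw [mul_inv_lt_iff₀ (by positivity)]
      push_cast; linarith
  obtain ⟨h, -, hcl, hfr⟩ := exists_homeomorph_image_interior_closure_frontier_eq_unitBall
    (convex_cornerSimplex (d := k + 1)) hne isBounded_cornerSimplex
  rw [isClosed_cornerSimplex.closure_eq] at hcl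
  have hsymm : ∀ y ∈ Metric.sphere (0 : EuclideanSpace ℝ (Fin (k + 1))) 1,
      h.symm y ∈ frontier (cornerSimplex (k + 1)) := fun y hy => by
    rw [← hfr] at hy
    obtain ⟨z, hz, rfl⟩ := hy
    simpa using hz
  obtain ⟨G, hG⟩ := hX.2 k hk ⟨fun y => f (raise (h.symm y)), by
    have h1 : Continuous fun y : Metric.sphere (0 : EuclideanSpace ℝ (Fin (k + 1))) 1 =>
        (⟨raise (h.symm y), hraisebd _ (hsymm y y.2)⟩ : simplexBoundary W) := by fun_prop
    exact (continuousOn_iff_continuous_domRestrict.1 hf).comp h1⟩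
  have hmem : ∀ x ∈ simplexOn W, h (drop x) ∈
      Metric.closedBall (0 : EuclideanSpace ℝ (Fin (k + 1))) 1 := fun x hx => by
    rw [← hcl]; exact ⟨_, hdropmem x hx, rfl⟩
  -- The value `f x` is a default, never taken on the simplex.
  refine ⟨fun x => if hx : h (drop x) ∈
      Metric.closedBall (0 : EuclideanSpace ℝ (Fin (k + 1))) 1 then G ⟨_, hx⟩ else f x, ?_, ?_⟩
  · rw [continuousOn_iff_continuous_domRestrict]
    have h1 : Continuous fun x : simplexOn W =>
        (⟨h (drop x), hmem x x.2⟩ :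
          Metric.closedBall (0 : EuclideanSpace ℝ (Fin (k + 1))) 1) := by fun_prop
    convert G.continuous.comp h1 using 1
    ext x
    simp only [Set.domRestrict_apply, Function.comp_apply]
    rw [dif_pos (hmem x x.2)]
  · intro x hx
    have hs : h (drop x) ∈ Metric.sphere (0 : EuclideanSpace ℝ (Fin (k + 1))) 1 := by
      rw [← hfr]; exact ⟨_, hdropbd x hx, rfl⟩
    refine (dif_pos (hmem x hx.1)).trans ((hG ⟨_, hs⟩).trans ?_)
    change f (raise (h.symm (h (drop x)))) = f x
    rw [h.symm_apply_apply, hrd x hx.1]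

/-! ### Small simplices in a highly connected complex -/

namespace SimplicialRealization

variable {V : Type*} (K : AbstractSimplicialComplex V)

theorem continuous_coord (v : V) : Continuous fun x : SimplicialRealization K => x.1 v := by
  refine continuous_iSup_dom.2 fun s => continuous_coinduced_dom.2 ?_
  let _ : TopologicalSpace (closedSimplex K s.1) :=
    TopologicalSpace.induced (fun x => (x.1.1 : V → ℝ)) Pi.topologicalSpace
  have h : Continuous fun x : closedSimplex K s.1 => (x.1.1 : V → ℝ) := continuous_induced_dom
  exact (continuous_apply v).comp h

/-- The point of the realization whose barycentric coordinates are the `x (some v)`, and `p` if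
there is no such point. -/
noncomputable def ofCoord (p : SimplicialRealization K) (x : Option V → ℝ) :
    SimplicialRealization K :=
  open scoped Classical in
  if h : (∀ v, 0 ≤ x (some v)) ∧ ∃ s ∈ K.faces, (∀ v, v ∉ s → x (some v) = 0) ∧
    ∑ v ∈ s, x (some v) = 1 then ⟨fun v => x (some v), h⟩ else p

variable {K}

theorem ofCoord_apply (p : SimplicialRealization K) {s : Finset V} (hs : s ∈ K.faces)
    {x : Option V → ℝ} (hx : x ∈ simplexOn (s.map .some)) :
    ∃ h, ofCoord K p x = ⟨fun v => x (some v), h⟩ := by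
  have h : (∀ v, 0 ≤ x (some v)) ∧ ∃ s ∈ K.faces, (∀ v, v ∉ s → x (some v) = 0) ∧
      ∑ v ∈ s, x (some v) = 1 :=
    ⟨fun v => hx.1 _, s, hs, fun v hv => hx.2.1 _ (by simpa using hv), by simpa using hx.2.2⟩
  exact ⟨h, dif_pos h⟩

/-- The map factors through one closed simplex, and continuity for the topology coinduced from that
simplex suffices. -/
theorem continuousOn_ofCoord (p : SimplicialRealization K) {s : Finset V} (hs : s ∈ K.faces) :
    ContinuousOn (ofCoord K p) (simplexOn (s.map .some)) := by
  rw [continuousOn_iff_continuous_domRestrict]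
  have hmem : ∀ x : simplexOn (s.map (.some : V ↪ Option V)), ofCoord K p x ∈ closedSimplex K s := by
    rintro ⟨x, hx⟩ v hv
    obtain ⟨h, e⟩ := ofCoord_apply p hs hx
    rw [e]
    exact hx.2.1 _ (by simpa using hv)
  refine continuous_iSup_rng (i := ⟨s, hs⟩) ?_
  let c : simplexOn (s.map (.some : V ↪ Option V)) → closedSimplex K s := fun x => ⟨_, hmem x⟩
  let t : TopologicalSpace (closedSimplex K s) :=
    TopologicalSpace.induced (fun x => (x.1.1 : V → ℝ)) Pi.topologicalSpace
  have hc : Continuous c := by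
    refine continuous_induced_rng.2 (continuous_pi fun v => ?_)
    have : (fun x : simplexOn (s.map (.some : V ↪ Option V)) => (c x).1.1 v) =
        fun x => x.1 (some v) := by
      ext x
      obtain ⟨h, e⟩ := ofCoord_apply p hs x.2
      change (ofCoord K p x).1 v = _
      rw [e]
    change Continuous fun x : simplexOn (s.map (.some : V ↪ Option V)) => (c x).1.1 v
    rw [this]
    exact (continuous_apply (some v)).comp continuous_subtype_val
  let _ : TopologicalSpace (SimplicialRealization K) :=
    TopologicalSpace.coinduced (Subtype.val : closedSimplex K s → SimplicialRealization K) t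
  have hv : Continuous (Subtype.val : closedSimplex K s → SimplicialRealization K) :=
    continuous_coinduced_rng
  exact hv.comp hc

end SimplicialRealization

open SimplicialRealization

theorem continuousOn_biUnion_finset {α β κ : Type*} [TopologicalSpace α] [TopologicalSpace β]
    {f : α → β} (I : Finset κ) {C : κ → Set α} (hC : ∀ i ∈ I, IsClosed (C i))
    (hf : ∀ i ∈ I, ContinuousOn f (C i)) : ContinuousOn f (⋃ i ∈ I, C i) := by
  classical
  induction I using Finset.induction_on with
  | empty => simp
  | insert i I hi ih =>
    rw [Finset.set_biUnion_insert]
    refine (hf i (by simp)).union_of_isClosed (ih (fun j hj => hC j (by simp [hj]))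
      fun j hj => hf j (by simp [hj])) (hC i (by simp)) ?_
    exact I.finite_toSet.isClosed_biUnion fun j hj => hC j (Finset.mem_insert_of_mem hj)

/-! ### Coning off simplices and approximating by vertices; `none` is the apex of the cones. -/

section ConeMap

variable {V : Type*} {K : AbstractSimplicialComplex V} {n : ℕ}

/-- Used to see that a point interior to the cone on `s` meets no other cone of the same or lower
dimension. -/
theorem subset_of_forall_ne_zero {s t : Finset V} {x : Option V → ℝ}
    (hx0 : ∀ v ∈ s.insertNone, x v ≠ 0)
    (ht : x ∈ simplexOn t.insertNone) : s ⊆ t := by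
  intro v hv
  by_contra hvt
  exact hx0 (some v) (by simpa using hv) (ht.2.1 _ (by simpa using hvt))

/-- In an `(n - 1)`-connected complex, the simplices of dimension less than `n` can be coned off
coherently. -/
theorem exists_cone_map (hK : IsPredConnected n (SimplicialRealization K)) :
    ∀ m ≤ n, ∃ F : (Option V → ℝ) → SimplicialRealization K,
      (∃ p, ∀ s ∈ K.faces, ∀ x ∈ simplexOn (s.map .some), F x = ofCoord K p x) ∧
      ∀ s : Finset V, (s = ∅ ∨ s ∈ K.faces) → s.card ≤ m →
        ContinuousOn F (simplexOn s.insertNone) := by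
  classical
  intro m
  induction m with
  | zero =>
    intro _
    obtain ⟨p⟩ := hK.1
    refine ⟨ofCoord K p, ⟨p, fun _ _ _ _ => rfl⟩, fun s _ hs => ?_⟩
    -- The only cone to consider is that over the empty simplex, which consists of the apex alone.
    obtain rfl : s = ∅ := Finset.card_eq_zero.1 (by omega)
    refine Set.Subsingleton.continuousOn (fun x (hx : x ∈ simplexOn _) y hy => ?_) _
    ext v
    by_cases hv : v ∈ Finset.insertNone (∅ : Finset V)
    · have h1 := hx.2.2
      have h2 := hy.2.2
      have e : Finset.insertNone (∅ : Finset V) = {none} := by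
        ext v; cases v <;> simp
      rw [e] at hv h1 h2
      rw [Finset.mem_singleton.1 hv]
      simp only [Finset.sum_singleton] at h1 h2
      rw [h1, h2]
    · rw [hx.2.1 v hv, hy.2.1 v hv]
  | succ m ih =>
    intro hm
    obtain ⟨F, ⟨p, hFp⟩, hF⟩ := ih (by omega)
    have hbd : ∀ s ∈ K.faces, s.card = m + 1 → ContinuousOn F (simplexBoundary s.insertNone) := by
      intro s hs hcard
      -- The boundary of the cone on `s` consists of the base and the cones on the facets of `s`;
      -- `F` is already continuous on each of these closed pieces.
      have h1 : ContinuousOn F (simplexOn (s.map .some) ∪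
          ⋃ v ∈ s, simplexOn (s.erase v).insertNone) := by
        refine ContinuousOn.union_of_isClosed ((continuousOn_ofCoord p hs).congr
          fun x hx => hFp s hs x hx) (continuousOn_biUnion_finset _
            (fun _ _ => isClosed_simplexOn _) fun v hv => ?_) (isClosed_simplexOn _)
          (s.finite_toSet.isClosed_biUnion fun v _ => isClosed_simplexOn _)
        refine hF _ ?_ (by rw [Finset.card_erase_of_mem hv]; omega)
        rcases (s.erase v).eq_empty_or_nonempty with h | h
        · exact .inl h
        · exact .inr ((K.isRelLowerSet_faces hs).2 (Finset.erase_subset v s) h)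
      refine h1.mono ?_
      rintro x ⟨hx, w, hw, hxw⟩
      cases w with
      | none =>
        left
        refine mem_simplexOn_of_subset (fun v hv => ?_) hx fun v hv hv' => ?_
        · obtain ⟨u, hu, rfl⟩ := Finset.mem_map.1 hv
          simpa using hu
        · cases v with
          | none => exact hxw
          | some v => exact absurd (by simpa using hv) (by simpa using hv')
      | some w =>
        right
        refine Set.mem_biUnion (x := w) (by simpa using hw) ?_
        refine mem_simplexOn_of_subset (Finset.insertNone.monotone (Finset.erase_subset w s)) hx
          fun v hv hv' => ?_
        cases v with
        | none => simp at hv'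
        | some v =>
          have h1 : v ∈ s := by simpa using hv
          obtain rfl : v = w := by
            by_contra hne
            exact hv' (by simp [hne, h1])
          exact hxw
    have hext : ∀ s : Finset V, ∃ g : (Option V → ℝ) → SimplicialRealization K,
        s ∈ K.faces → s.card = m + 1 → ContinuousOn g (simplexOn s.insertNone) ∧
          ∀ x ∈ simplexBoundary s.insertNone, g x = F x := by
      intro s
      by_cases hs : s ∈ K.faces ∧ s.card = m + 1
      · obtain ⟨g, hg⟩ := exists_continuousOn_simplexOn_extension hK (k := m) (by omega)
          (W := s.insertNone) (by rw [Finset.card_insertNone, hs.2]) F (hbd s hs.1 hs.2)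
        exact ⟨g, fun _ _ => hg⟩
      · exact ⟨F, fun h1 h2 => absurd ⟨h1, h2⟩ hs⟩
    choose g hg using hext
    -- `P x s` places `x` in the interior of the cone on `s`. Such `s` is unique, so the extensions
    -- `g s` can be glued by changing `F` only on these interiors.
    let P : (Option V → ℝ) → Finset V → Prop := fun x s =>
      s ∈ K.faces ∧ s.card = m + 1 ∧ x ∈ simplexOn s.insertNone ∧ ∀ v ∈ s.insertNone, x v ≠ 0
    refine ⟨fun x => if h : ∃ s, P x s then g h.choose x else F x, ⟨p, fun s hs x hx => ?_⟩,
      fun s hs hcard => ?_⟩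
    · refine (dif_neg ?_).trans (hFp s hs x hx)
      rintro ⟨t, -, -, -, ht⟩
      exact ht none (by simp) (hx.2.1 _ (by simp))
    · rcases hcard.lt_or_eq with hlt | heq
      · refine (hF s hs (by omega)).congr fun x hx => dif_neg ?_
        rintro ⟨t, -, ht2, -, ht4⟩
        have := Finset.card_le_card (subset_of_forall_ne_zero ht4 hx)
        omega
      · have hs' : s ∈ K.faces := hs.resolve_left (by rintro rfl; simp at heq)
        refine (hg s hs' heq).1.congr fun x hx => ?_
        by_cases h : ∃ t, P x t
        · have h1 := subset_of_forall_ne_zero h.choose_spec.2.2.2 hx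
          have h2 := Finset.eq_of_subset_of_card_le h1 (by rw [h.choose_spec.2.1, heq])
          simp only [dif_pos h, h2]
        · simp only [dif_neg h]
          refine ((hg s hs' heq).2 x ⟨hx, ?_⟩).symm
          by_contra! h'
          exact h ⟨s, hs', heq, hx, h'⟩

/-- The elements of the sequence `l` span a face of `K` (unless `l` is empty). -/
def SpansFace (K : AbstractSimplicialComplex V) (l : List V) : Prop :=
  ∀ t : Finset V, t.Nonempty → (∀ v ∈ t, v ∈ l) → t ∈ K.faces

/-- An entourage of the product contains one restricting finitely many coordinates, so the minimum
of finitely many radii works. -/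
theorem exists_uniform_radius {ι : Type*} {U : Set ((ι → ℝ) × (ι → ℝ))}
    (hU : U ∈ uniformity (ι → ℝ)) :
    ∃ ε > 0, ∀ x y : ι → ℝ, (∀ v, |x v - y v| ≤ ε) → (x, y) ∈ U := by
  rw [Pi.uniformity] at hU
  obtain ⟨I, hI, W, hW, rfl⟩ := Filter.mem_iInf.1 hU
  have h : ∀ i : I, ∃ ε > 0, ∀ x y : ι → ℝ, |x i - y i| < ε → (x, y) ∈ W i := fun i => by
    obtain ⟨T, hT, hTW⟩ := Filter.mem_comap.1 (hW i)
    obtain ⟨ε, hε, h⟩ := Metric.mem_uniformity_dist.1 hT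
    exact ⟨ε, hε, fun x y hxy => hTW (h hxy)⟩
  choose ε hε h using h
  have := hI.to_subtype
  obtain ⟨δ, hδ, hδε⟩ : ∃ δ > 0, ∀ i, δ < ε i := by
    obtain ⟨δ, h1, h2⟩ := (((Filter.eventually_all (l := 𝓝[>] (0 : ℝ))).2 fun i : I =>
      (eventually_lt_nhds (hε i)).filter_mono nhdsWithin_le_nhds).and self_mem_nhdsWithin).exists
    exact ⟨δ, h2, h1⟩
  refine ⟨δ, hδ, fun x y hxy => Set.mem_iInter.2 fun i => h i x y ((hxy i).trans_lt (hδε i))⟩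

/-- Points of finitely many cones over simplices of dimension less than `n` can be assigned vertices
of `K`, such that sets of nearby points go to faces, and the bases of the cones to themselves. -/
theorem exists_vertex_assignment (hK : IsPredConnected n (SimplicialRealization K))
    (S : Finset (Finset V)) (hS : ∀ s ∈ S, (s = ∅ ∨ s ∈ K.faces) ∧ s.card ≤ n) :
    ∃ ψ : (Option V → ℝ) → V, ∃ ε > 0,
      (∀ s ∈ S, ∀ q : List (Option V → ℝ), (∀ x ∈ q, x ∈ simplexOn s.insertNone) →
        (∀ x ∈ q, ∀ y ∈ q, ∀ v, |x v - y v| ≤ ε) → SpansFace K (q.map ψ)) ∧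
      ∀ s ∈ S, ∀ x ∈ simplexOn (s.map .some), 0 < x (some (ψ x)) := by
  classical
  obtain ⟨F, ⟨p, hFp⟩, hF⟩ := exists_cone_map hK n le_rfl
  have hpos : ∀ x : SimplicialRealization K, ∃ v, 0 < x.1 v := by
    rintro ⟨x, h0, s, hs, h1, h2⟩
    by_contra! h
    have : ∑ v ∈ s, x v ≤ 0 := Finset.sum_nonpos fun v _ => h v
    linarith
  have : Nonempty V := ⟨(hpos p).choose⟩
  set C : Set (Option V → ℝ) := ⋃ s ∈ S, simplexOn s.insertNone
  have hC : IsCompact C := S.isCompact_biUnion fun s _ => isCompact_simplexOn _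
  have hFC : ContinuousOn F C := continuousOn_biUnion_finset S
    (fun s _ => isClosed_simplexOn _) fun s hs => hF s (hS s hs).1 (hS s hs).2
  -- The open stars of the vertices cover the realization; their preimages cover the compact set
  -- `C`. A Lebesgue number gives, for each `x`, a vertex `ψ x` whose star contains the image of a
  -- whole neighbourhood of `x` of uniform size.
  have hU : ∀ v : V, ∃ U, IsOpen U ∧ F ⁻¹' {x | 0 < x.1 v} ∩ C = U ∩ C := fun v =>
    continuousOn_iff'.1 hFC _ (isOpen_lt continuous_const (continuous_coord K v))
  choose U hUo hU using hU
  obtain ⟨E, hE, hEU⟩ := lebesgue_number_lemma hC hUo fun x hx => by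
    obtain ⟨v, hv⟩ := hpos (F x)
    have : x ∈ U v ∩ C := (hU v).subset ⟨hv, hx⟩
    exact Set.mem_iUnion.2 ⟨v, this.1⟩
  choose! ψ hψ using hEU
  obtain ⟨ε, hε, h⟩ := exists_uniform_radius hE
  have key : ∀ x ∈ C, ∀ y ∈ C, (∀ v, |x v - y v| ≤ ε) → 0 < (F y).1 (ψ x) := by
    intro x hx y hy hxy
    have : y ∈ U (ψ x) := hψ x hx (h x y hxy)
    exact ((hU (ψ x)).superset ⟨this, hy⟩).1
  refine ⟨ψ, ε, hε, fun s hs q hq hq' t ht htq => ?_, fun s hs x hx => ?_⟩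
  · have hqC : ∀ x ∈ q, x ∈ C := fun x hx => Set.mem_biUnion hs (hq x hx)
    obtain ⟨v, hv⟩ := ht
    obtain ⟨y, hy, rfl⟩ := List.mem_map.1 (htq v hv)
    -- By `key`, the image of one point `y` of the sequence has positive coordinate at every `ψ x`,
    -- so a face carrying `F y` contains all these vertices.
    obtain ⟨-, σ, hσ, hσ0, -⟩ := (F y).2
    refine (K.isRelLowerSet_faces hσ).2 (fun w hw => ?_) ⟨_, hv⟩
    obtain ⟨x, hx, rfl⟩ := List.mem_map.1 (htq w hw)
    by_contra hne
    exact (key x (hqC x hx) y (hqC y hy) (hq' x hx y hy)).ne' (hσ0 _ hne)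
  · have hxC : x ∈ C := Set.mem_biUnion hs (simplexOn_mono (fun v hv => by
      obtain ⟨u, hu, rfl⟩ := Finset.mem_map.1 hv
      simpa using hu) hx)
    have h1 := key x hxC x hxC (by simpa using hε.le)
    have hs' : s ∈ K.faces := (hS s hs).1.resolve_left (by
      rintro rfl
      simpa using hx.2.2)
    obtain ⟨h2, e⟩ := ofCoord_apply p hs' hx
    rw [hFp s hs' x hx, e] at h1
    exact h1

end ConeMap

/-! ### Exactness of the chain complex of a highly connected complex -/

section Exactness

open ListChain

variable {V : Type*} {K : AbstractSimplicialComplex V} {n : ℕ}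

theorem SpansFace.mono {l l' : List V} (h : SpansFace K l) (h' : ∀ v ∈ l', v ∈ l) :
    SpansFace K l' :=
  fun t ht htl => h t ht fun v hv => h' v (htl v hv)

/-- The sequences of `m` vertices of `K` which span a face. -/
def faceLists (K : AbstractSimplicialComplex V) (m : ℕ) : Set (List V) :=
  {l | l.length = m ∧ SpansFace K l}

/-- Subdividing and applying `ψ` gives a chain map `T`. Since `ψ` sends a point of a simplex of `z`
to a vertex of that simplex, a prism inside faces joins `z` to `T z`. Doing the same to the cone on
`z` gives a chain bounded by `T z`, as `z` is a cycle; fine mesh ensures that its sequences span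
faces. -/
theorem exists_boundary_eq (hK : IsPredConnected n (SimplicialRealization K)) {m : ℕ}
    (hm : m ≤ n) {z : ListChain V} (hz : z ∈ Finsupp.supported ℤ ℤ (faceLists K m))
    (hz0 : boundary z = 0) :
    ∃ w ∈ Finsupp.supported ℤ ℤ (faceLists K (m + 1)), boundary w = z := by
  classical
  obtain ⟨ψ, ε, hε, hψ, hψ'⟩ := exists_vertex_assignment hK (z.support.image List.toFinset)
    fun s hs => by
      obtain ⟨l, hl, rfl⟩ := Finset.mem_image.1 hs
      have hl' : l ∈ faceLists K m := hz hl
      refine ⟨?_, (List.toFinset_card_le l).trans (hl'.1.trans_le hm)⟩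
      rcases l.toFinset.eq_empty_or_nonempty with h | h
      · exact .inl h
      · exact .inr (hl'.2 _ h fun v hv => List.mem_toFinset.1 hv)
  -- The sequences in the cone on `z` have `m + 1` points, so their subdivision has mesh at most `(m
  -- + 1) / N`.
  obtain ⟨N, hN⟩ := exists_nat_gt ((m + 1) / ε)
  have hN0 : (0 : ℝ) < N := lt_of_le_of_lt (by positivity) hN
  have hN1 : N ≠ 0 := by rintro rfl; simp at hN0
  have hNε : (m + 1 : ℝ) / N ≤ ε := by
    rw [div_le_iff₀ hN0, mul_comm]
    rw [div_lt_iff₀ hε] at hN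
    exact hN.le
  let e : Option V → Option V → ℝ := fun v => Pi.single v 1
  let T : ListChain V →ₗ[ℤ] ListChain V := push ψ ∘ₗ subdivision N e ∘ₗ push some
  have hT : ∀ c, boundary (T c) = T (boundary c) := fun c => by
    simp only [T, LinearMap.comp_apply, boundary_push, boundary_subdivision hN1]
  have hT0 : T (Finsupp.single [] 1) = Finsupp.single [] 1 := by
    simp [T, subdivision_nil]
  have hz' : z ∈ Finsupp.supported ℤ ℤ (z.support : Set (List V)) :=
    (Finsupp.mem_supported _ _).2 le_rfl
  have hpush : push (id : V → V) z = z := by simp [push]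
  refine ⟨push ψ (subdivision N e (cone none (push some z))) - prism id T z,
    Submodule.sub_mem _ ?_ ?_, ?_⟩
  · have h1 : push ψ (subdivision N e (cone none (push some z))) =
        (push ψ ∘ₗ subdivision N e ∘ₗ cone none ∘ₗ push some) z := rfl
    rw [h1]
    refine map_mem_supported (fun l hl => ?_) hz'
    have hl' : l ∈ faceLists K m := hz hl
    simp only [LinearMap.comp_apply, push_single, cone_single]
    refine push_mem_supported (fun q hq => ?_) (subdivision_mem_supported hN1 e
      (convex_simplexOn l.toFinset.insertNone)
      (fun x hx y hy => abs_sub_le_one_of_mem_simplexOn hx hy) _ fun v hv => ?_)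
    · refine ⟨by simp [hq.1, hl'.1], hψ l.toFinset (Finset.mem_image_of_mem _ hl) q hq.2.1
        fun x hx y hy v => (hq.2.2 x hx y hy v).trans (le_trans ?_ hNε)⟩
      simp [hl'.1]
    · refine single_mem_simplexOn ?_
      rcases List.mem_cons.1 hv with rfl | hv
      · simp
      · obtain ⟨u, hu, rfl⟩ := List.mem_map.1 hv
        simpa using hu
  · refine map_mem_supported (fun l hl => ?_) hz'
    have hl' : l ∈ faceLists K m := hz hl
    refine Finsupp.supported_mono ?_ (prism_single_mem_supported id T (fun x y => x = y) l
      fun l' hl'' => ?_)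
    · rintro q ⟨hq1, hq2⟩
      refine ⟨by rw [hq1, hl'.1], hl'.2.mono fun v hv => ?_⟩
      obtain ⟨u, hu, rfl | rfl⟩ := hq2 v hv <;> exact hu
    · simp only [T, LinearMap.comp_apply, push_single]
      refine push_mem_supported (fun q hq => ?_) (subdivision_mem_supported hN1 e
        (convex_simplexOn (l'.toFinset.map .some))
        (fun x hx y hy => abs_sub_le_one_of_mem_simplexOn hx hy) _ fun v hv => ?_)
      · refine ⟨by simpa using hq.1, fun y hy => ?_⟩
        obtain ⟨x, hx, rfl⟩ := List.mem_map.1 hy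
        have hxl := hq.2.1 x hx
        have h1 := hψ' l.toFinset (Finset.mem_image_of_mem _ hl) x
          (simplexOn_mono (Finset.map_subset_map.2 fun v hv => List.mem_toFinset.2
            (hl''.subset (List.mem_toFinset.1 hv))) hxl)
        refine ⟨_, ?_, rfl⟩
        by_contra hne
        exact h1.ne' (hxl.2.1 _ (by simpa using hne))
      · refine single_mem_simplexOn ?_
        obtain ⟨u, hu, rfl⟩ := List.mem_map.1 hv
        simpa using hu
  · have h1 := boundary_prism id T hT hT0 z
    rw [hz0, map_zero, add_zero, hpush] at h1
    rw [map_sub, h1, boundary_push, boundary_subdivision hN1, boundary_cone, boundary_push, hz0]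
    simp [T]

end Exactness

/-! ### Representations on chains -/

section ChainRep

open ListChain CategoryTheory

variable (Γ : Type) [Group Γ] {V : Type} [MulAction Γ V]

/-- The representation of `Γ` on the chains of a `Γ`-set. -/
noncomputable def chainRep (V : Type) [MulAction Γ V] : Representation ℤ Γ (ListChain V) where
  toFun g := push (g • ·)
  map_one' := linearMap_ext fun l => by simp
  map_mul' g h := linearMap_ext fun l => by simp [mul_smul, Function.comp_def]

variable {Γ}

@[simp] theorem chainRep_single (g : Γ) (l : List V) (a : ℤ) :
    chainRep Γ V g (Finsupp.single l a) = Finsupp.single (l.map (g • ·)) a :=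
  push_single _ _ _

theorem boundary_chainRep (g : Γ) (c : ListChain V) :
    boundary (chainRep Γ V g c) = chainRep Γ V g (boundary c) :=
  boundary_push _ _

/-- The chains carried by a `Γ`-stable set of sequences. -/
noncomputable def supportedSubrep (P : Set (List V))
    (hP : ∀ (g : Γ), ∀ l ∈ P, l.map (g • ·) ∈ P) : Subrepresentation (chainRep Γ V) where
  toSubmodule := Finsupp.supported ℤ ℤ P
  apply_mem_toSubmodule g _ hc := push_mem_supported (hP g) hc

/-- The cycles carried by a `Γ`-stable set of sequences. -/
noncomputable def cycleSubrep (P : Set (List V))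
    (hP : ∀ (g : Γ), ∀ l ∈ P, l.map (g • ·) ∈ P) : Subrepresentation (chainRep Γ V) where
  toSubmodule := Finsupp.supported ℤ ℤ P ⊓ LinearMap.ker boundary
  apply_mem_toSubmodule g c hc := by
    refine ⟨push_mem_supported (hP g) hc.1, ?_⟩
    change boundary (chainRep Γ V g c) = 0
    rw [boundary_chainRep, LinearMap.mem_ker.1 hc.2, map_zero]

/-- Choose a representative `rep l` of each orbit and `γ l` carrying it to `l`. Freeness makes `γ l`
unique for `l ∈ P`, hence equivariant. -/
theorem exists_orbit_section (P : Set (List V))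
    (hP : ∀ (g : Γ), ∀ l ∈ P, l.map (g • ·) ∈ P)
    (hfree : ∀ (g : Γ), ∀ l ∈ P, l.map (g • ·) = l → g = 1) :
    ∃ (rep : List V → List V) (γ : List V → Γ), (∀ l, (rep l).map (γ l • ·) = l) ∧
      (∀ (g : Γ) l, rep (l.map (g • ·)) = rep l) ∧
      (∀ l ∈ P, rep l ∈ P) ∧ ∀ (g : Γ), ∀ l ∈ P, γ (l.map (g • ·)) = g * γ l := by
  have hmap : ∀ (g h : Γ) (l : List V), (l.map (h • ·)).map (g • ·) = l.map ((g * h) • ·) :=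
    fun g h l => by simp [mul_smul, Function.comp_def]
  have hone : ∀ l : List V, l.map ((1 : Γ) • ·) = l := fun l => by simp
  let S : Setoid (List V) :=
    { r := fun l l' => ∃ g : Γ, l.map (g • ·) = l'
      iseqv :=
        { refl := fun l => ⟨1, hone l⟩
          symm := by
            rintro l _ ⟨g, rfl⟩
            exact ⟨g⁻¹, by rw [hmap, inv_mul_cancel, hone]⟩
          trans := by
            rintro l _ _ ⟨g, rfl⟩ ⟨h, rfl⟩
            exact ⟨h * g, by rw [hmap]⟩ } }
  have h1 : ∀ l, ∃ g : Γ, ((Quotient.mk S l).out).map (g • ·) = l := fun l =>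
    Quotient.mk_out (s := S) l
  choose γ hγ using h1
  have h2 : ∀ (g : Γ) l, (Quotient.mk S (l.map (g • ·))).out = (Quotient.mk S l).out := fun g l => by
    rw [Quotient.sound (s := S) (a := l.map (g • ·)) (b := l) (S.iseqv.symm ⟨g, rfl⟩)]
  have h3 : ∀ l ∈ P, (Quotient.mk S l).out ∈ P := fun l hl => by
    obtain ⟨g, hg⟩ := S.iseqv.symm (Quotient.mk_out (s := S) l)
    exact hg ▸ hP g l hl
  refine ⟨fun l => (Quotient.mk S l).out, γ, hγ, h2, h3, fun g l hl => ?_⟩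
  have h4 : (Quotient.mk S l).out.map (γ (l.map (g • ·)) • ·) =
      (Quotient.mk S l).out.map ((g * γ l) • ·) := by
    rw [← hmap, hγ, ← h2 g l, hγ]
  have h5 := congrArg (List.map ((g * γ l)⁻¹ • ·)) h4
  rw [hmap, hmap, inv_mul_cancel, hone] at h5
  exact (inv_mul_eq_one.1 (hfree _ _ (h3 l hl) h5)).symm

/-- The map from a free representation to the chains carried by `P` which sends the basis to a
given set of sequences. -/
noncomputable def supportedLift (P : Set (List V))
    (hP : ∀ (g : Γ), ∀ l ∈ P, l.map (g • ·) ∈ P) (T : Set (List V)) (hTP : T ⊆ P) :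
    (Representation.free ℤ Γ T).IntertwiningMap (supportedSubrep P hP).toRepresentation :=
  Representation.freeLift _ fun l => ⟨Finsupp.single l.1 1, single_mem_supported (hTP l.2)⟩

theorem supportedLift_single (P : Set (List V))
    (hP : ∀ (g : Γ), ∀ l ∈ P, l.map (g • ·) ∈ P) (T : Set (List V)) (hTP : T ⊆ P) (t : T) (g : Γ) :
    (supportedLift P hP T hTP (Finsupp.single t (MonoidAlgebra.single g 1))).1 =
      Finsupp.single (t.1.map (g • ·)) 1 := by
  rw [supportedLift, Representation.freeLift_single_single, one_smul]
  exact chainRep_single g t.1 1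

/-- Evaluation from the free module on all of `P` has the equivariant section `l ↦ γ l • rep l`, so
the chains are a retract of a free module. -/
theorem projective_supportedSubrep (P : Set (List V))
    (hP : ∀ (g : Γ), ∀ l ∈ P, l.map (g • ·) ∈ P)
    (hfree : ∀ (g : Γ), ∀ l ∈ P, l.map (g • ·) = l → g = 1) :
    Projective (Rep.of (supportedSubrep P hP).toRepresentation) := by
  classical
  obtain ⟨rep, γ, hγ, hrep, hrepP, hγP⟩ := exists_orbit_section P hP hfree
  let q := supportedLift P hP P subset_rfl
  let i : ListChain V →ₗ[ℤ] (P →₀ MonoidAlgebra ℤ Γ) := Finsupp.linearCombination ℤ fun l =>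
    if h : l ∈ P then Finsupp.single ⟨rep l, hrepP l h⟩ (MonoidAlgebra.single (γ l) 1) else 0
  have hi : ∀ l (h : l ∈ P), i (Finsupp.single l 1) =
      Finsupp.single ⟨rep l, hrepP l h⟩ (MonoidAlgebra.single (γ l) 1) := fun l h => by
    simp [i, h]
  have hspan : ∀ c ∈ Finsupp.supported ℤ ℤ P, c ∈ Submodule.span ℤ
      ((fun l => Finsupp.single l (1 : ℤ)) '' P) := fun c hc => by
    rwa [← Finsupp.supported_eq_span_single]
  have hequi : ∀ g, ∀ c ∈ Finsupp.supported ℤ ℤ P,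
      i (chainRep Γ V g c) = Representation.free ℤ Γ P g (i c) := by
    intro g c hc
    have hc' := hspan c hc
    clear hc
    induction hc' using Submodule.span_induction with
    | mem c hc =>
      obtain ⟨l, hl, rfl⟩ := hc
      rw [chainRep_single, hi _ (hP g l hl), hi l hl, Representation.free_single_single]
      simp only [hrep, hγP g l hl]
    | zero => simp
    | add x y hx hy ihx ihy =>
      rw [map_add, map_add, map_add, map_add, ihx, ihy]
    | smul a x hx ihx =>
      rw [map_smul, map_smul, map_smul, map_smul, ihx]
  let j : (supportedSubrep P hP).toRepresentation.IntertwiningMap (Representation.free ℤ Γ P) :=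
    ⟨i ∘ₗ (Finsupp.supported ℤ ℤ P).subtype, fun g => LinearMap.ext fun c =>
      hequi g c.1 c.2⟩
  have hqi : ∀ c ∈ Finsupp.supported ℤ ℤ P, (q (i c)).1 = c := by
    intro c hc
    have hc' := hspan c hc
    clear hc
    induction hc' using Submodule.span_induction with
    | mem c hc =>
      obtain ⟨l, hl, rfl⟩ := hc
      rw [hi l hl, supportedLift_single, hγ]
    | zero => simp
    | add x y hx hy ihx ihy => rw [map_add, map_add, Submodule.coe_add, ihx, ihy]
    | smul a x hx ihx => rw [map_smul, map_smul, Submodule.coe_smul, ihx]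
  refine Retract.projective (Y := Rep.free ℤ Γ P) ⟨Rep.ofHom j, Rep.ofHom q, ?_⟩
  exact Rep.hom_ext (Representation.IntertwiningMap.ext (LinearMap.ext fun c =>
    Subtype.ext (hqi c.1 c.2)))

/-- A representation is finitely generated if it is a quotient of a free representation of finite
rank. -/
def IsFinGen (M : Rep.{0} ℤ Γ) : Prop :=
  ∃ (R : Type) (_ : Finite R) (r : Rep.free ℤ Γ R ⟶ M), Function.Surjective r.hom

theorem IsFinGen.of_surjective {M N : Rep.{0} ℤ Γ} (hM : IsFinGen M) (f : M ⟶ N)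
    (hf : Function.Surjective f.hom) : IsFinGen N := by
  obtain ⟨R, hR, r, hr⟩ := hM
  exact ⟨R, hR, r ≫ f, hf.comp hr⟩

theorem isFinGen_supportedSubrep (P : Set (List V))
    (hP : ∀ (g : Γ), ∀ l ∈ P, l.map (g • ·) ∈ P) (T : Set (List V)) (hT : T.Finite) (hTP : T ⊆ P)
    (hPT : ∀ l ∈ P, ∃ g : Γ, ∃ t ∈ T, l = t.map (g • ·)) :
    IsFinGen (Rep.of (supportedSubrep P hP).toRepresentation) := by
  refine ⟨T, hT, Rep.ofHom (supportedLift P hP T hTP), ?_⟩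
  have h : Finsupp.supported ℤ ℤ P ≤ LinearMap.range
      ((supportedSubrep P hP).toSubmodule.subtype ∘ₗ (supportedLift P hP T hTP).toLinearMap) := by
    refine (Finsupp.supported_eq_span_single ℤ P).trans_le (Submodule.span_le.2 ?_)
    rintro _ ⟨l, hl, rfl⟩
    obtain ⟨g, t, ht, rfl⟩ := hPT l hl
    exact ⟨Finsupp.single ⟨t, ht⟩ (MonoidAlgebra.single g 1), supportedLift_single P hP T hTP _ _⟩
  rintro ⟨c, hc⟩
  obtain ⟨x, hx⟩ := h hc
  exact ⟨x, Subtype.ext hx⟩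

end ChainRep

/-! ### Dimension shifting along the chain complex -/

section Shift

open ListChain CategoryTheory

theorem subrep_shortExact {k Γ : Type} [CommRing k] [Group Γ] {W : Type} [AddCommGroup W]
    [Module k W] {ρ : Representation k Γ W}
    (A B C : Subrepresentation ρ) (hAB : A.toSubmodule ≤ B.toSubmodule)
    (d : W →ₗ[k] W) (hd : ∀ g w, d (ρ g w) = ρ g (d w))
    (hBC : ∀ b ∈ B.toSubmodule, d b ∈ C.toSubmodule)
    (hker : ∀ b ∈ B.toSubmodule, d b = 0 ↔ b ∈ A.toSubmodule)
    (hsurj : ∀ c ∈ C.toSubmodule, ∃ b ∈ B.toSubmodule, d b = c) :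
    ∃ (f : Rep.of A.toRepresentation ⟶ Rep.of B.toRepresentation)
      (g : Rep.of B.toRepresentation ⟶ Rep.of C.toRepresentation) (w : f ≫ g = 0),
      (ShortComplex.mk f g w).ShortExact := by
  let f : A.toRepresentation.IntertwiningMap B.toRepresentation :=
    ⟨Submodule.inclusion hAB, fun g => rfl⟩
  let g : B.toRepresentation.IntertwiningMap C.toRepresentation :=
    ⟨d.restrict hBC, fun g => LinearMap.ext fun b => Subtype.ext (hd g b.1)⟩
  have w : Rep.ofHom f ≫ Rep.ofHom g = 0 :=
    Rep.hom_ext (Representation.IntertwiningMap.ext (LinearMap.ext fun a =>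
      Subtype.ext ((hker a.1 (hAB a.2)).2 a.2)))
  refine ⟨Rep.ofHom f, Rep.ofHom g, w, ?_⟩
  have := (Rep.mono_iff_injective (Rep.ofHom f)).2 (Submodule.inclusion_injective hAB)
  have := (Rep.epi_iff_surjective (Rep.ofHom g)).2 fun c => by
    obtain ⟨b, hb, hbc⟩ := hsurj c.1 c.2
    exact ⟨⟨b, hb⟩, Subtype.ext hbc⟩
  refine ⟨?_⟩
  rw [← ShortComplex.exact_map_iff_of_faithful _ (forget₂ (Rep.{0} k Γ) (ModuleCat.{0} k)),
    ShortComplex.moduleCat_exact_iff]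
  intro b hb
  exact ⟨(⟨b.1, (hker b.1 b.2).1 (congrArg Subtype.val hb)⟩ : A.toSubmodule), rfl⟩

end Shift

/-! ### Dimension shifting for `Ext` in an abelian category. -/

section ExtShift

open CategoryTheory Abelian

universe w v u

variable {C : Type u} [Category.{v} C] [Abelian C]

/-- Passing to a syzygy lowers a bound on the projective dimension by one; after `n` steps the bound
says projective. -/
theorem projective_of_shortExact_sequence (n : ℕ) : ∀ (Z P : ℕ → C),
    (∀ j < n, ∃ (f : Z (j + 1) ⟶ P j) (g : P j ⟶ Z j) (w : f ≫ g = 0),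
      (ShortComplex.mk f g w).ShortExact) →
    (∀ j < n, Projective (P j)) → HasProjectiveDimensionLT (Z 0) (n + 1) → Projective (Z n) := by
  induction n with
  | zero => intro Z P _ _ h; exact projective_iff_hasProjectiveDimensionLT_one.2 h
  | succ n ih =>
    intro Z P hS hP h
    obtain ⟨f, g, w, hS0⟩ := hS 0 (by omega)
    refine ih (fun j => Z (j + 1)) (fun j => P (j + 1)) (fun j hj => hS (j + 1) (by omega))
      (fun j hj => hP (j + 1) (by omega)) ?_
    exact (hS0.hasProjectiveDimensionLT_X₃_iff n (hP 0 (by omega))).1 h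

variable [HasExt.{w} C]

theorem subsingleton_ext_succ_iff {S : ShortComplex C} (hS : S.ShortExact) [Projective S.X₂]
    (A : C) (m : ℕ) : Subsingleton (Ext S.X₃ A (m + 2)) ↔ Subsingleton (Ext S.X₁ A (m + 1)) := by
  have h0 : ∀ k (x : Ext S.X₂ A (k + 1)), x = 0 := fun k x =>
    x.eq_zero_of_hasProjectiveDimensionLT 1 (by omega)
  constructor
  · intro h
    refine subsingleton_of_forall_eq 0 fun x => ?_
    obtain ⟨y, rfl⟩ := Ext.contravariant_sequence_exact₁ hS A x (n₁ := m + 2) (by omega)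
      (Subsingleton.elim _ _)
    rw [h0 _ y, Ext.comp_zero]
  · intro h
    refine subsingleton_of_forall_eq 0 fun x => ?_
    obtain ⟨y, rfl⟩ := Ext.contravariant_sequence_exact₃ hS A x (h0 _ _) (n₀ := m + 1) (by omega)
    rw [Subsingleton.elim y 0, Ext.comp_zero]

/-- The last shift differs from the others because `Hom(X₂, A)` need not vanish: `Ext¹(X₃, A)` is
the cokernel of restriction from `X₂` to `X₁`. -/
theorem subsingleton_ext_one_iff {S : ShortComplex C} (hS : S.ShortExact) [Projective S.X₂]
    (A : C) : Subsingleton (Ext S.X₃ A 1) ↔ ∀ f : S.X₁ ⟶ A, ∃ h : S.X₂ ⟶ A, S.f ≫ h = f := by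
  constructor
  · intro h f
    obtain ⟨y, hy⟩ := Ext.contravariant_sequence_exact₁ hS A (Ext.mk₀ f) (n₁ := 1) (by omega)
      (Subsingleton.elim _ _)
    obtain ⟨h, rfl⟩ := Ext.homEquiv₀.symm.surjective y
    refine ⟨h, Ext.homEquiv₀.symm.injective ?_⟩
    change (Ext.mk₀ S.f).comp (Ext.mk₀ h) (zero_add 0) = Ext.mk₀ f at hy
    rw [Ext.mk₀_comp_mk₀] at hy
    exact hy
  · intro h
    refine subsingleton_of_forall_eq 0 fun x => ?_
    obtain ⟨y, rfl⟩ := Ext.contravariant_sequence_exact₃ hS A x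
      (Ext.eq_zero_of_hasProjectiveDimensionLT _ 1 (by omega)) (n₀ := 0) (by omega)
    obtain ⟨f, rfl⟩ := Ext.homEquiv₀.symm.surjective y
    obtain ⟨h, rfl⟩ := h f
    change hS.extClass.comp (Ext.mk₀ (S.f ≫ h)) _ = 0
    rw [← Ext.mk₀_comp_mk₀]
    exact hS.extClass_comp_assoc _

theorem subsingleton_ext_congr {X X' : C} (e : X ≅ X') (A : C) (m : ℕ) :
    Subsingleton (Ext X A m) ↔ Subsingleton (Ext X' A m) := by
  have key : ∀ {X X' : C} (_ : X ≅ X'), Subsingleton (Ext X A m) → Subsingleton (Ext X' A m) := by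
    intro X X' e h
    refine subsingleton_of_forall_eq 0 fun x => ?_
    have h1 : (Ext.mk₀ e.inv).comp ((Ext.mk₀ e.hom).comp x (zero_add m)) (zero_add m) = x := by
      simp
    rw [← h1, Subsingleton.elim ((Ext.mk₀ e.hom).comp x (zero_add m)) 0, Ext.comp_zero]
  exact ⟨key e, key e.symm⟩

theorem subsingleton_ext_shortExact_sequence_iff (A : C) (m : ℕ) : ∀ (Z P : ℕ → C),
    (∀ j < m, ∃ (f : Z (j + 1) ⟶ P j) (g : P j ⟶ Z j) (w : f ≫ g = 0),
      (ShortComplex.mk f g w).ShortExact) →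
    (∀ j < m, Projective (P j)) →
      (Subsingleton (Ext (Z 0) A (m + 1)) ↔ Subsingleton (Ext (Z m) A 1)) := by
  induction m with
  | zero => intro Z P _ _; exact Iff.rfl
  | succ m ih =>
    intro Z P hS hP
    obtain ⟨f, g, w, hS0⟩ := hS 0 (by omega)
    have : Projective (ShortComplex.mk f g w).X₂ := hP 0 (by omega)
    exact (subsingleton_ext_succ_iff hS0 A m).trans
      (ih (fun j => Z (j + 1)) (fun j => P (j + 1)) (fun j hj => hS (j + 1) (by omega))
        (fun j hj => hP (j + 1) (by omega)))

end ExtShift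

/-! ### Projectivity and finiteness of the chains of a complex witnessing type `F_n`. -/

section TypeF

open ListChain CategoryTheory Abelian

variable {Γ : Type} [Group Γ] {V : Type} [MulAction Γ V] {K : AbstractSimplicialComplex V}

theorem mem_translateSimplex {g : Γ} {σ : Finset V} {v : V} :
    v ∈ translateSimplex g σ ↔ g⁻¹ • v ∈ σ := by
  simp only [translateSimplex, Finset.mem_map]
  constructor
  · rintro ⟨u, hu, rfl⟩
    simpa using hu
  · exact fun h => ⟨_, h, by simp⟩

theorem map_mem_faceLists (hK : ∀ (g : Γ), ∀ σ ∈ K.faces, translateSimplex g σ ∈ K.faces) (m : ℕ)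
    (g : Γ) (l : List V) (hl : l ∈ faceLists K m) : l.map (g • ·) ∈ faceLists K m := by
  refine ⟨by simp [hl.1], fun t ht htl => ?_⟩
  have h1 : translateSimplex g⁻¹ t ∈ K.faces := by
    refine hl.2 _ (by simpa [translateSimplex] using ht) fun _ hv => ?_
    rw [mem_translateSimplex, inv_inv] at hv
    obtain ⟨u, hu, huv⟩ := List.mem_map.1 (htl _ hv)
    rwa [← MulAction.injective g huv]
  convert hK g _ h1
  ext v
  simp [mem_translateSimplex]

theorem SpansFace.toFinset_mem [DecidableEq V] {l : List V} (hl : SpansFace K l) (hl0 : l ≠ []) :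
    l.toFinset ∈ K.faces :=
  hl _ (List.toFinset_nonempty_iff l |>.2 hl0) fun _ hv => List.mem_toFinset.1 hv

/-- A sequence fixed by `g` has a fixed set of vertices, which is a simplex. The length is `m + 1`
because the empty sequence is fixed by every element. -/
theorem eq_one_of_map_eq
    (hfree : ∀ (g : Γ), ∀ σ ∈ K.faces, translateSimplex g σ = σ → g = 1) (m : ℕ) (g : Γ)
    (l : List V) (hl : l ∈ faceLists K (m + 1)) (h : l.map (g • ·) = l) : g = 1 := by
  classical
  have hl0 : l ≠ [] := by rintro rfl; simpa using hl.1
  refine hfree g _ (hl.2.toFinset_mem hl0) ?_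
  ext v
  rw [mem_translateSimplex, List.mem_toFinset, List.mem_toFinset]
  nth_rw 2 [← h]
  rw [List.mem_map]
  exact ⟨fun h => ⟨_, h, by simp⟩, by rintro ⟨u, hu, rfl⟩; simpa using hu⟩

/-- Sequences may repeat vertices, but each finite set of vertices carries only finitely many
sequences of a given length. -/
theorem exists_finite_faceLists {n : ℕ} (T : Set (Finset V)) (hT : T.Finite)
    (hK : ∀ (g : Γ), ∀ σ ∈ K.faces, translateSimplex g σ ∈ K.faces)
    (hKT : ∀ σ ∈ K.faces, σ.card ≤ n + 1 → ∃ g : Γ, ∃ τ ∈ T, σ = translateSimplex g τ)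
    {m : ℕ} (hm : m ≤ n) :
    ∃ T' : Set (List V), T'.Finite ∧ T' ⊆ faceLists K (m + 1) ∧
      ∀ l ∈ faceLists K (m + 1), ∃ g : Γ, ∃ t ∈ T', l = t.map (g • ·) := by
  classical
  refine ⟨{l | l ∈ faceLists K (m + 1) ∧ ∃ τ ∈ T, ∀ v ∈ l, v ∈ τ}, ?_, fun l hl => hl.1, ?_⟩
  · refine (hT.biUnion (t := fun τ => {l : List V | l.length = m + 1 ∧ ∀ v ∈ l, v ∈ τ})
      fun τ _ => ?_).subset ?_
    · refine ((List.finite_length_eq τ (m + 1)).image (List.map Subtype.val)).subset ?_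
      rintro l ⟨hl, hlτ⟩
      lift l to List τ using hlτ
      exact ⟨l, by simpa using hl, rfl⟩
    · rintro l ⟨hl, τ, hτ, h⟩
      exact Set.mem_biUnion hτ ⟨hl.1, h⟩
  · intro l hl
    have hl0 : l ≠ [] := by rintro rfl; simpa using hl.1
    obtain ⟨g, τ, hτ, h⟩ := hKT _ (hl.2.toFinset_mem hl0)
      ((List.toFinset_card_le l).trans (by rw [hl.1]; omega))
    refine ⟨g, l.map (g⁻¹ • ·), ⟨map_mem_faceLists hK _ _ l hl, τ, hτ, fun v hv => ?_⟩,
      by simp [Function.comp_def]⟩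
    obtain ⟨u, hu, rfl⟩ := List.mem_map.1 hv
    rw [← List.mem_toFinset, h, mem_translateSimplex] at hu
    exact hu

/-- The representation on the chains of sequences of `m` vertices which span a face of `K`. -/
noncomputable abbrev faceChains
    (hK : ∀ (g : Γ), ∀ σ ∈ K.faces, translateSimplex g σ ∈ K.faces) (m : ℕ) : Rep.{0} ℤ Γ :=
  Rep.of (supportedSubrep (faceLists K m) (map_mem_faceLists hK m)).toRepresentation

/-- The representation on the cycles of sequences of `m` vertices which span a face of `K`. -/
noncomputable abbrev faceCycles
    (hK : ∀ (g : Γ), ∀ σ ∈ K.faces, translateSimplex g σ ∈ K.faces) (m : ℕ) : Rep.{0} ℤ Γ :=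
  Rep.of (cycleSubrep (faceLists K m) (map_mem_faceLists hK m)).toRepresentation

/-- Only surjectivity onto the cycles has content; it is `exists_boundary_eq`. -/
theorem faceChains_shortExact (hK : ∀ (g : Γ), ∀ σ ∈ K.faces, translateSimplex g σ ∈ K.faces)
    {n : ℕ} (hconn : IsPredConnected n (SimplicialRealization K)) {m : ℕ} (hm : m ≤ n) :
    ∃ (f : faceCycles hK (m + 1) ⟶ faceChains hK (m + 1))
      (g : faceChains hK (m + 1) ⟶ faceCycles hK m) (w : f ≫ g = 0),
      (ShortComplex.mk f g w).ShortExact := by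
  refine subrep_shortExact (cycleSubrep _ (map_mem_faceLists hK (m + 1)))
    (supportedSubrep _ (map_mem_faceLists hK (m + 1))) (cycleSubrep _ (map_mem_faceLists hK m))
    inf_le_left boundary boundary_chainRep (fun c hc => ⟨?_, boundary_boundary c⟩)
    (fun c hc => ⟨fun h => ⟨hc, h⟩, fun h => h.2⟩) fun c hc => exists_boundary_eq hconn hm hc.1 hc.2
  refine map_mem_supported (fun l hl => ?_) hc
  refine Finsupp.supported_mono ?_ (boundary_single_mem_supported l)
  rintro q ⟨hq1, hq2⟩
  exact ⟨by have := hl.1; omega, hl.2.mono hq2⟩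

theorem faceLists_zero : faceLists K 0 = {[]} := by
  ext l
  simp only [faceLists, List.length_eq_zero_iff, Set.mem_singleton_iff]
  refine ⟨fun h => h.1, fun h => ⟨h, ?_⟩⟩
  subst h
  rintro t ⟨v, hv⟩ htl
  exact absurd (htl v hv) (by simp)

/-- The augmentation module is trivial. -/
theorem nonempty_faceCycles_zero_iso
    (hK : ∀ (g : Γ), ∀ σ ∈ K.faces, translateSimplex g σ ∈ K.faces) :
    Nonempty (Rep.trivial ℤ Γ ℤ ≅ faceCycles hK 0) := by
  have hmem : ∀ a : ℤ, Finsupp.single [] a ∈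
      (cycleSubrep _ (map_mem_faceLists hK 0)).toSubmodule := fun a => by
    refine ⟨?_, ?_⟩
    · rw [faceLists_zero]
      exact Finsupp.single_mem_supported ℤ a rfl
    · change boundary (Finsupp.single [] a) = 0
      rw [← mul_one a, ← smul_eq_mul, ← Finsupp.smul_single, map_smul, boundary_nil, smul_zero]
  have hsingle : ∀ c ∈ (cycleSubrep _ (map_mem_faceLists hK 0)).toSubmodule,
      Finsupp.single [] (c []) = c := by
    rintro c ⟨hc, -⟩
    rw [faceLists_zero] at hc
    ext l
    by_cases hl : l = []
    · subst hl; simp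
    · rw [Finsupp.single_apply, if_neg (Ne.symm hl)]
      by_contra hne
      exact hl (hc (Finsupp.mem_support_iff.2 (Ne.symm hne)))
  let f : (Representation.trivial ℤ Γ ℤ).IntertwiningMap
      (cycleSubrep _ (map_mem_faceLists hK 0)).toRepresentation :=
    ⟨(Finsupp.lsingle []).codRestrict _ hmem, fun g => LinearMap.ext fun a => Subtype.ext
      (chainRep_single g [] a).symm⟩
  refine ⟨@asIso _ _ _ _ (Rep.ofHom f) ?_⟩
  have := (Rep.mono_iff_injective (Rep.ofHom f)).2 fun a b h =>
    Finsupp.single_injective [] (congrArg Subtype.val h)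
  have := (Rep.epi_iff_surjective (Rep.ofHom f)).2 fun c =>
    ⟨c.1 [], Subtype.ext (hsingle c.1 c.2)⟩
  exact isIso_of_mono_of_epi _

/-- For a group of type `F_n` and of cohomological dimension at most `n`, the vanishing of the
`n`-th cohomology is an extension property along a morphism of finitely generated projective
modules. -/
theorem exists_projective_of_isTypeF [HasExt.{0} (Rep.{0} ℤ Γ)] {n : ℕ} (hF : IsTypeF n Γ)
    (hcd : cohomologicalDimension Γ ≤ n) :
    ∃ (M Y : Rep.{0} ℤ Γ) (i : M ⟶ Y), Projective M ∧ Projective Y ∧ IsFinGen M ∧ IsFinGen Y ∧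
      ∀ A : Rep.{0} ℤ Γ, Subsingleton (Ext (Rep.trivial ℤ Γ ℤ) A n) ↔
        ∀ f : M ⟶ A, ∃ h : Y ⟶ A, i ≫ h = f := by
  obtain ⟨V, _, K, hK, hfree, ⟨T, hT, -, hKT⟩, hconn⟩ := hF
  obtain ⟨e⟩ := nonempty_faceCycles_zero_iso hK
  have hproj : ∀ m, Projective (faceChains hK (m + 1)) := fun m =>
    projective_supportedSubrep _ _ (eq_one_of_map_eq hfree m)
  have hfg : ∀ m ≤ n, IsFinGen (faceChains hK (m + 1)) := fun m hm => by
    obtain ⟨T', hT', hT'P, h⟩ := exists_finite_faceLists T hT hK hKT hm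
    exact isFinGen_supportedSubrep _ _ T' hT' hT'P h
  have hM : Projective (faceCycles hK n) := by
    refine projective_of_shortExact_sequence n (faceCycles hK) (fun j => faceChains hK (j + 1))
      (fun j hj => faceChains_shortExact hK hconn hj.le) (fun j _ => hproj j) ?_
    have : HasProjectiveDimensionLT (Rep.trivial ℤ Γ ℤ) (n + 1) :=
      (projectiveDimension_le_iff _ _).1 hcd
    exact hasProjectiveDimensionLT_of_iso e (n + 1)
  -- Sequences of length `n + 1` span faces of dimension at most `n`, so both exactness and the
  -- finite skeleton are used in their last available degree.
  have hMfg : IsFinGen (faceCycles hK n) := by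
    obtain ⟨f, g, w, hS⟩ := faceChains_shortExact hK hconn le_rfl
    exact (hfg n le_rfl).of_surjective g ((Rep.epi_iff_surjective g).1 hS.epi_g)
  cases n with
  | zero =>
    -- In degree zero `Ext` is `Hom(ℤ, A)`, and `M ≅ ℤ`; extension along the map to the zero module
    -- says exactly that every `M ⟶ A` is zero.
    have hz : Limits.IsZero (Rep.free ℤ Γ Empty) := (Rep.isZero_iff ℤ Γ _).2
      (inferInstanceAs (Subsingleton (Empty →₀ MonoidAlgebra ℤ Γ)))
    refine ⟨_, Rep.free ℤ Γ Empty, 0, hM, inferInstance, hMfg,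
      ⟨Empty, inferInstance, 𝟙 _, Function.surjective_id⟩, fun A => ?_⟩
    rw [subsingleton_ext_congr e, Ext.homEquiv₀.subsingleton_congr]
    simp only [Limits.zero_comp, exists_const_iff]
    exact ⟨fun h f => ⟨⟨hz.to_ _⟩, Subsingleton.elim _ _⟩,
      fun h => ⟨fun f g => (h f).2.symm.trans (h g).2⟩⟩
  | succ m =>
    obtain ⟨f, g, w, hS⟩ := faceChains_shortExact hK hconn (Nat.le_succ m)
    refine ⟨_, _, f, hM, hproj m, hMfg, hfg m (Nat.le_succ m), fun A => ?_⟩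
    have : Projective (ShortComplex.mk f g w).X₂ := hproj m
    rw [subsingleton_ext_congr e, subsingleton_ext_shortExact_sequence_iff A m (faceCycles hK)
      (fun j => faceChains hK (j + 1)) (fun j hj => faceChains_shortExact hK hconn (by omega))
      (fun j _ => hproj j)]
    exact subsingleton_ext_one_iff hS A

end TypeF

/-! ### Group cohomology as `Ext` over the integral group ring. -/

section Cohomology

open CategoryTheory Abelian

theorem subsingleton_groupCohomology_succ_iff {k Γ : Type} [CommRing k] [Group Γ]
    (A : Rep.{0} k Γ) (m : ℕ) : Subsingleton (groupCohomology A (m + 1)) ↔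
      ∀ f : (Fin (m + 1) → Γ) → A, inhomogeneousCochains.d A (m + 1) f = 0 →
        ∃ g : (Fin m → Γ) → A, inhomogeneousCochains.d A m g = f := by
  rw [← ModuleCat.isZero_iff_subsingleton, groupCohomology,
    ← HomologicalComplex.exactAt_iff_isZero_homology,
    HomologicalComplex.exactAt_iff' _ m (m + 1) (m + 2) (by simp) (by simp),
    ShortComplex.moduleCat_exact_iff]
  change (∀ f : (Fin (m + 1) → Γ) → A,
    (groupCohomology.inhomogeneousCochains A).d (m + 1) (m + 1 + 1) f = 0 →
      ∃ g : (Fin m → Γ) → A, (groupCohomology.inhomogeneousCochains A).d m (m + 1) g = f) ↔ _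
  rw [groupCohomology.inhomogeneousCochains.d_def, groupCohomology.inhomogeneousCochains.d_def]

/-- Both sides are computed by maps out of the bar resolution. -/
theorem subsingleton_groupCohomology_succ_iff_ext {k Γ : Type} [CommRing k] [Group Γ]
    [HasExt.{0} (Rep.{0} k Γ)] (A : Rep.{0} k Γ) (m : ℕ) :
    Subsingleton (groupCohomology A (m + 1)) ↔
      Subsingleton (Ext (Rep.trivial k Γ k) A (m + 1)) := by
  let R := Rep.barResolution k Γ
  rw [(groupCohomologyIso A (m + 1) R).toLinearEquiv.toEquiv.subsingleton_congr,
    ← ModuleCat.isZero_iff_subsingleton,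
    ← HomologicalComplex.exactAt_iff_isZero_homology,
    HomologicalComplex.exactAt_iff' _ m (m + 1) (m + 2) (by simp) (by simp),
    ShortComplex.moduleCat_exact_iff]
  have h1 : Subsingleton (Ext (Rep.trivial k Γ k) A (m + 1)) ↔
      ∀ f : R.complex.X (m + 1) ⟶ A, R.complex.d (m + 2) (m + 1) ≫ f = 0 →
        ∃ g : R.complex.X m ⟶ A, R.complex.d (m + 1) m ≫ g = f := by
    constructor
    · intro h f hf
      exact (R.extMk_eq_zero_iff f (m + 2) rfl hf m rfl).1 (Subsingleton.elim _ _)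
    · intro h
      refine subsingleton_of_forall_eq 0 fun x => ?_
      obtain ⟨f, hf, rfl⟩ := R.extMk_surjective x (m + 2) rfl
      exact (R.extMk_eq_zero_iff f (m + 2) rfl hf m rfl).2 (h f hf)
  rw [h1]
  exact Iff.rfl

variable {Γ : Type} [Group Γ] {H : Type} [NormedAddCommGroup H] [InnerProductSpace ℂ H]
  [CompleteSpace H]

/-- The `ℤ[Γ]`-module underlying a unitary representation. -/
noncomputable def unitaryRepInt (π : Γ →* unitary (H →L[ℂ] H)) : Representation ℤ Γ H where
  toFun g := (unitaryRep π g).toAddMonoidHom.toIntLinearMap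
  map_one' := by ext; simp
  map_mul' g h := by ext; simp

theorem unitaryRepInt_apply (π : Γ →* unitary (H →L[ℂ] H)) (g : Γ) (v : H) :
    unitaryRepInt π g v = (π g : H →L[ℂ] H) v := rfl

theorem unitaryRep_apply (π : Γ →* unitary (H →L[ℂ] H)) (g : Γ) (v : H) :
    unitaryRep π g v = (π g : H →L[ℂ] H) v := rfl

/-- Inhomogeneous cochains and their differentials do not see the scalars, so `ℂ` can be replaced by
`ℤ`. In degree zero both sides describe invariant vectors. -/
theorem subsingleton_groupCohomology_unitaryRep_iff [HasExt.{0} (Rep.{0} ℤ Γ)]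
    (π : Γ →* unitary (H →L[ℂ] H)) (n : ℕ) :
    Subsingleton (groupCohomology (Rep.of (unitaryRep π)) n) ↔
      Subsingleton (Ext (Rep.trivial ℤ Γ ℤ) (Rep.of (unitaryRepInt π)) n) := by
  cases n with
  | zero =>
    rw [(groupCohomology.H0Iso (Rep.of (unitaryRep π))).toLinearEquiv.toEquiv.subsingleton_congr,
      Ext.homEquiv₀.subsingleton_congr]
    constructor
    · intro h
      refine subsingleton_of_forall_eq 0 fun f => Rep.hom_ext
        (Representation.IntertwiningMap.ext (LinearMap.ext_ring ?_))
      have h1 : ∀ g, unitaryRep π g (f.hom (1 : ℤ)) = f.hom (1 : ℤ) := fun g =>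
        (Rep.hom_comm_apply f g (1 : ℤ)).symm
      exact congrArg Subtype.val (Subsingleton.elim
        (⟨f.hom (1 : ℤ), h1⟩ : (unitaryRep π).invariants) 0)
    · intro h
      refine subsingleton_of_forall_eq 0 fun v => ?_
      let v' : (unitaryRep π).invariants := v
      let f : (Representation.trivial ℤ Γ ℤ).IntertwiningMap (unitaryRepInt π) :=
        ⟨LinearMap.toSpanSingleton ℤ H v'.1, fun g => LinearMap.ext_ring (by
          have := v'.2 g
          simpa [unitaryRepInt_apply, unitaryRep_apply] using this.symm)⟩
      have h2 := congrArg (fun f : Rep.trivial ℤ Γ ℤ ⟶ Rep.of (unitaryRepInt π) => f.hom (1 : ℤ))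
        (Subsingleton.elim (Rep.ofHom f) 0)
      refine Subtype.ext ?_
      simpa [f] using h2
  | succ m =>
    rw [← subsingleton_groupCohomology_succ_iff_ext, subsingleton_groupCohomology_succ_iff,
      subsingleton_groupCohomology_succ_iff]
    have hd : ∀ (j : ℕ) (f : (Fin j → Γ) → H),
        inhomogeneousCochains.d (Rep.of (unitaryRep π)) j f =
          inhomogeneousCochains.d (Rep.of (unitaryRepInt π)) j f := by
      intro j f
      funext g
      rw [inhomogeneousCochains.d_hom_apply, inhomogeneousCochains.d_hom_apply]
      refine congrArg₂ _ rfl (Finset.sum_congr rfl fun i _ => ?_)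
      rcases Nat.even_or_odd ((i : ℕ) + 1) with h | h <;> simp [h.neg_one_pow]
    constructor
    · intro h f hf
      obtain ⟨g, hg⟩ := h f ((hd (m + 1) f).trans hf)
      exact ⟨g, (hd m g).symm.trans hg⟩
    · intro h f hf
      obtain ⟨g, hg⟩ := h f ((hd (m + 1) f).symm.trans hf)
      exact ⟨g, (hd m g).trans hg⟩

end Cohomology

/-! ### Stability of surjectivity -/

/-- The open mapping theorem gives a right inverse, possibly nonlinear, with a norm bound. A
perturbation smaller than the inverse of that bound stays surjective, by the iteration behind the
inverse function theorem. -/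
theorem ContinuousLinearMap.isOpen_setOf_surjective {𝕜 E F : Type*} [NontriviallyNormedField 𝕜]
    [NormedAddCommGroup E] [NormedSpace 𝕜 E] [CompleteSpace E] [NormedAddCommGroup F]
    [NormedSpace 𝕜 F] [CompleteSpace F] : IsOpen {T : E →L[𝕜] F | Function.Surjective T} := by
  rw [Metric.isOpen_iff]
  intro T hT
  let N := T.nonlinearRightInverseOfSurjective (LinearMap.range_eq_top.2 hT)
  have hN : 0 < N.nnnorm := T.nonlinearRightInverseOfSurjective_nnnorm_pos _
  refine ⟨(N.nnnorm : ℝ)⁻¹, by positivity, fun T' hT' y => ?_⟩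
  rw [Metric.mem_ball, dist_eq_norm] at hT'
  have happrox : ApproximatesLinearOn T' T Set.univ ‖T' - T‖₊ := fun a _ b _ => by
    have := (T' - T).le_opNorm (a - b)
    simpa [map_sub, sub_sub_sub_comm] using this
  have hpos : 0 < (N.nnnorm : ℝ)⁻¹ - ‖T' - T‖ := sub_pos.2 hT'
  -- The radius `ε` is chosen so that the ball known to be covered has radius exactly `‖y‖`.
  obtain ⟨x, -, hx⟩ := happrox.surjOn_closedBall_of_nonlinearRightInverse N (b := 0)
    (ε := ‖y‖ / ((N.nnnorm : ℝ)⁻¹ - ‖T' - T‖)) (by positivity) (Set.subset_univ _)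
    (show y ∈ _ by
      rw [map_zero, mem_closedBall_zero_iff, coe_nnnorm, mul_div_cancel₀ _ hpos.ne'])
  exact ⟨x, hx⟩

/-! ### Openness of the extension property. -/

section Openness

open CategoryTheory

variable {Γ : Type} [Group Γ] {H : Type} [NormedAddCommGroup H] [InnerProductSpace ℂ H]
  [CompleteSpace H] {X : Type*} [TopologicalSpace X] {ρ : X → (Γ →* unitary (H →L[ℂ] H))}

/-- The module underlying a unitary representation, as an object of the category of
representations. -/
noncomputable abbrev unitaryModule (π : Γ →* unitary (H →L[ℂ] H)) : Rep.{0} ℤ Γ :=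
  Rep.of (unitaryRepInt π)

/-- Evaluating at a fixed element of the free module is a finite integral combination of operators
`ρ x g` composed with coordinate projections. -/
theorem exists_continuous_freeLift {R : Type} [Finite R]
    (hρ : ∀ g, Continuous fun x => (ρ x g : H →L[ℂ] H)) (c : R →₀ MonoidAlgebra ℤ Γ) :
    ∃ E : X → ((R → H) →L[ℂ] H), Continuous E ∧
      ∀ x u, Representation.freeLift (unitaryRepInt (ρ x)) u c = E x u := by
  have := Fintype.ofFinite R
  induction c using Finsupp.induction_linear with
  | zero => exact ⟨0, continuous_const, by simp⟩
  | add c c' hc hc' =>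
    obtain ⟨E, hE, h⟩ := hc
    obtain ⟨E', hE', h'⟩ := hc'
    exact ⟨fun x => E x + E' x, hE.add hE', fun x u => by simp [h, h']⟩
  | single y c =>
    induction c using MonoidAlgebra.induction_linear with
    | zero => exact ⟨0, continuous_const, by simp⟩
    | add c c' hc hc' =>
      obtain ⟨E, hE, h⟩ := hc
      obtain ⟨E', hE', h'⟩ := hc'
      exact ⟨fun x => E x + E' x, hE.add hE', fun x u => by
        rw [Finsupp.single_add, map_add, h, h', add_apply]⟩
    | single g a =>
      refine ⟨fun x => a • ((ρ x g : H →L[ℂ] H) ∘L ContinuousLinearMap.proj y),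
        ((hρ g).clm_comp continuous_const).const_smul a, fun x u => ?_⟩
      rw [Representation.freeLift_single_single, unitaryRepInt_apply]
      rfl

/-- Maps from a free module of rank `R` to `H` form the fixed space `R → H`, but those from its
summand `M` form a subspace varying with `x`. Adding the idempotent `Q`, which fills the
complementary summand, avoids this: `T x (u, w)` combines restriction along `D` with `Q` applied to
`w`, and is onto the whole fixed space exactly when extension is possible. -/
theorem isOpen_setOf_forall_exists_comp_eq (hρ : ∀ g, Continuous fun x => (ρ x g : H →L[ℂ] H))
    {M Y : Rep.{0} ℤ Γ} (i : M ⟶ Y) [Projective M] [Projective Y] (hM : IsFinGen M)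
    (hY : IsFinGen Y) :
    IsOpen {x | ∀ f : M ⟶ unitaryModule (ρ x), ∃ h : Y ⟶ unitaryModule (ρ x), i ≫ h = f} := by
  classical
  obtain ⟨R, _, r, hr⟩ := hM
  obtain ⟨R', _, r', hr'⟩ := hY
  have := Fintype.ofFinite R
  have := Fintype.ofFinite R'
  have := (Rep.epi_iff_surjective r).2 hr
  have := (Rep.epi_iff_surjective r').2 hr'
  let s := Projective.factorThru (𝟙 M) r
  let s' := Projective.factorThru (𝟙 Y) r'
  have hs : s ≫ r = 𝟙 M := Projective.factorThru_comp _ _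
  have hs' : s' ≫ r' = 𝟙 Y := Projective.factorThru_comp _ _
  let D : Rep.free ℤ Γ R ⟶ Rep.free ℤ Γ R' := r ≫ i ≫ s'
  let Q : Rep.free ℤ Γ R ⟶ Rep.free ℤ Γ R := 𝟙 _ - r ≫ s
  let e : R → (R →₀ MonoidAlgebra ℤ Γ) := fun a => Finsupp.single a (MonoidAlgebra.single 1 1)
  choose E hE hEe using fun a => exists_continuous_freeLift (R := R') hρ (D.hom (e a))
  choose F hF hFe using fun a => exists_continuous_freeLift (R := R) hρ (Q.hom (e a))
  let T : X → ((R' → H) × (R → H) →L[ℂ] (R → H)) := fun x =>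
    ∑ a, ContinuousLinearMap.single ℂ (fun _ => H) a ∘L
      (E a x ∘L ContinuousLinearMap.fst ℂ _ _ + F a x ∘L ContinuousLinearMap.snd ℂ _ _)
  have hT : Continuous T := continuous_finsetSum _ fun a _ => continuous_const.clm_comp
    (((hE a).clm_comp continuous_const).add ((hF a).clm_comp continuous_const))
  have hTa : ∀ x u w a, T x (u, w) a =
      ((D ≫ Rep.freeLift ℤ Γ (A := unitaryModule (ρ x)) u) +
        (Q ≫ Rep.freeLift ℤ Γ (A := unitaryModule (ρ x)) w)).hom (e a) := by
    intro x u w a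
    have h1 : T x (u, w) a = E a x u + F a x w := by
      simp [T, Finset.sum_apply, Pi.single_apply, Finset.sum_add_distrib]
    rw [h1, ← hEe, ← hFe]
    rfl
  have hlift : ∀ x (f : Rep.free ℤ Γ R ⟶ unitaryModule (ρ x)) (v : R → H),
      (∀ a, f.hom (e a) = v a) ↔ f = Rep.freeLift ℤ Γ (A := unitaryModule (ρ x)) v := by
    intro x f v
    have h1 : ∀ a, (Rep.freeLift ℤ Γ (A := unitaryModule (ρ x)) v).hom (e a) = v a := fun a => by
      have := Representation.freeLift_single_single (unitaryRepInt (ρ x)) a 1 1 v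
      rw [map_one, one_smul] at this
      exact this
    constructor
    · intro h
      exact Rep.free_ext ℤ Γ _ _ _ fun a => (h a).trans (h1 a).symm
    · rintro rfl
      exact h1
  have hsurj : ∀ x, (∀ f : M ⟶ unitaryModule (ρ x), ∃ h : Y ⟶ unitaryModule (ρ x), i ≫ h = f) ↔
      Function.Surjective (T x) := by
    intro x
    constructor
    · intro hx v
      obtain ⟨h, hh⟩ := hx (s ≫ Rep.freeLift ℤ Γ (A := unitaryModule (ρ x)) v)
      let u : R' → H := fun y => (r' ≫ h).hom (Finsupp.single y (MonoidAlgebra.single 1 1))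
      have hu : Rep.freeLift ℤ Γ (A := unitaryModule (ρ x)) u = r' ≫ h :=
        Rep.hom_ext ((Representation.freeLiftLEquiv (unitaryRepInt (ρ x)) R').symm_apply_apply
          (r' ≫ h).hom)
      -- The `D` term contributes the part of `v` factoring through `M`, and the `Q` term
      -- contributes the rest of `v`.
      refine ⟨(u, v), funext fun a => ?_⟩
      rw [hTa, hu]
      refine (hlift x _ v).2 ?_ a
      simp only [D, Q, Category.assoc, Preadditive.sub_comp, Category.id_comp]
      rw [reassoc_of% hs', hh]
      abel
    · intro hx f
      obtain ⟨⟨u, w⟩, huw⟩ := hx fun a => (r ≫ f).hom (e a)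
      have h1 := (hlift x _ _).1 fun a => (hTa x u w a).symm.trans (congrFun huw a)
      rw [← (hlift x (r ≫ f) _).1 fun a => rfl] at h1
      refine ⟨s' ≫ Rep.freeLift ℤ Γ (A := unitaryModule (ρ x)) u, ?_⟩
      -- Precomposing with `s` kills the `Q` term, since `s ≫ r = 𝟙 M`.
      have h2 := congrArg (s ≫ ·) h1
      simp only [D, Q, Category.assoc, Preadditive.sub_comp, Category.id_comp,
        Preadditive.comp_add, Preadditive.comp_sub] at h2
      rw [reassoc_of% hs, reassoc_of% hs, reassoc_of% hs, sub_self, add_zero] at h2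
      exact h2
  simp only [hsurj]
  exact ContinuousLinearMap.isOpen_setOf_surjective.preimage hT

end Openness

/-! ### Continuity in the representation, and the conclusion. -/

theorem continuous_apply_of_closure_eq_top {Γ : Type} [Group Γ] {H : Type} [NormedAddCommGroup H]
    [InnerProductSpace ℂ H] [CompleteSpace H] (S : Finset Γ)
    (hS : Subgroup.closure (S : Set Γ) = ⊤) (g : Γ) :
    Continuous[homTopology S hS, inferInstance]
      fun π : Γ →* unitary (H →L[ℂ] H) => (π g : H →L[ℂ] H) := by
  let _ : TopologicalSpace (Γ →* unitary (H →L[ℂ] H)) := homTopology S hS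
  have hg : g ∈ Subgroup.closure (S : Set Γ) := hS ▸ Subgroup.mem_top g
  have hr : Continuous (restrictToGenerators S :
      (Γ →* unitary (H →L[ℂ] H)) → S → (H →L[ℂ] H)) := continuous_induced_dom
  change Continuous fun π : Γ →* unitary (H →L[ℂ] H) => (π g : H →L[ℂ] H)
  induction hg using Subgroup.closure_induction with
  | mem s hs => exact (continuous_apply (⟨s, hs⟩ : S)).comp hr
  | one => simpa using continuous_const
  | mul g h _ _ ihg ihh =>
    simp only [map_mul, Submonoid.coe_mul]
    exact ihg.mul ihh
  | inv g _ ih =>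
    -- Inverses of unitaries are adjoints, and the adjoint is norm continuous.
    simp only [map_inv, ← Unitary.star_eq_inv, Unitary.coe_star]
    exact ih.star

theorem mainTheorem12 {Γ : Type} [Group Γ] (n : ℕ) (hF : IsTypeF n Γ)
    (hcd : cohomologicalDimension Γ = (n : WithBot ℕ∞))
    {H : Type} [NormedAddCommGroup H] [InnerProductSpace ℂ H] [CompleteSpace H]
    (S : Finset Γ) (hS : Subgroup.closure (S : Set Γ) = ⊤) :
    IsClosed[homTopology S hS] (nonvanishingSet Γ H n) := by
  let _ : TopologicalSpace (Γ →* unitary (H →L[ℂ] H)) := homTopology S hS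
  have : CategoryTheory.HasExt.{0} (Rep.{0} ℤ Γ) := CategoryTheory.hasExt_of_enoughProjectives _
  obtain ⟨M, Y, i, _, _, hM, hY, h⟩ := exists_projective_of_isTypeF hF hcd.le
  refine isOpen_compl_iff.1 ?_
  have heq : (nonvanishingSet Γ H n)ᶜ = {π | ∀ f : M ⟶ unitaryModule π,
      ∃ h : Y ⟶ unitaryModule π, CategoryTheory.CategoryStruct.comp i h = f} := by
    ext π
    rw [Set.mem_compl_iff, nonvanishingSet, Set.mem_ofPred_eq, not_nontrivial_iff_subsingleton,
      subsingleton_groupCohomology_unitaryRep_iff, h]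
    rfl
  rw [heq]
  exact isOpen_setOf_forall_exists_comp_eq (ρ := id)
    (continuous_apply_of_closure_eq_top S hS) i hM hY
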